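/- Let $d\ge 2$ and $n\ge 0$, and let $A_i,B_i,A'_i,B'_i$ ($1\le i\le n$) be systems with Hilbert space $\mathbb C^d$; write $A^n=A_1\cdots A_n$, and similarly for $B^n,A'^n,B'^n$. Regard $(\wedge^2\mathbb C^d)^{\otimes n}$ as a subspace of $A^nB^n$, the $i$-th factor being the antisymmetric subspace of $A_iB_i$. For $y\in\{1111,\,22,\,211\}$ let $V_y\subseteq \wedge^2\mathbb C^d\otimes\wedge^2\mathbb C^d\subseteq A_iB_i\otimes A'_iB'_i$ be the sum of all subrepresentations of $g\mapsto g^{\otimes 4}$, $g\in U(d)$, that are irreducible with highest weight $y$ (i.e. with Young diagram $y$), and, if $V_y\neq 0$, let $\rho_y=P_{V_y}/\dim V_y$ be the normalised orthogonal projector onto it ($V_y=0$ if $y$ has more than $d$ rows; such $y$ are left out below). Then $$\max_{\psi}\ \operatorname{tr}\psi_{A^n}^2 \;=\; \max_{\Omega}\ \operatorname{tr}\,\Omega_{A^nA'^n}F_{A^n:A'^n},$$ both maxima being attained. Here the first maximum is over unit vectors $|\psi\rangle\in(\wedge^2\mathbb C^d)^{\otimes n}$, with $\psi_{A^n}=\operatorname{tr}_{B^n}|\psi\rangle\langle\psi|$.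 The second maximum is over all states (density operators) $\Omega$ on $A^nB^nA'^nB'^n$ that (i) have the form $\Omega=\sum_{y_1,\dots,y_n}p_{y_1\dots y_n}\,\rho_{y_1}\otimes\cdots\otimes\rho_{y_n}$ with a probability distribution $p$ on words in $\{1111,22,211\}$, where $\rho_{y_i}$ acts on $A_iB_iA'_iB'_i$; (ii) are separable across the cut $A^nB^n:A'^nB'^n$, i.e. are finite convex combinations of products of a state on $A^nB^n$ and a state on $A'^nB'^n$; (iii) are invariant under all permutations of the $n$ groups $A_iB_iA'_iB'_i$. Moreover $\Omega_{A^nA'^n}=\operatorname{tr}_{B^nB'^n}\Omega$, and $F_{A^n:A'^n}$ is the operator that exchanges $A^n$ and $A'^n$. -/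

import Mathlib

open scoped Kronecker ComplexConjugate ComplexOrder

noncomputable section

namespace AntisymPurity

/-! ### States, partial trace, separability -/

/-- A density matrix: positive semidefinite of trace one. -/
def IsState {ι : Type*} [Fintype ι] (ρ : Matrix ι ι ℂ) : Prop :=
  ρ.PosSemidef ∧ ρ.trace = 1

/-- The rank-one matrix `|ψ⟩⟨ψ|`. -/
def ketBra {ι : Type*} (ψ : EuclideanSpace ℂ ι) : Matrix ι ι ℂ :=
  Matrix.of fun x z => ψ x * conj (ψ z)

/-- Partial trace over the second tensor factor. -/
def traceSecond {α β : Type*} [Fintype β] (ρ : Matrix (α × β) (α × β) ℂ) : Matrix α α ℂ :=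
  Matrix.of fun a c => ∑ b, ρ (a, b) (c, b)

/-- Separability across the cut `α : β`: a finite convex combination of product states. -/
def IsSeparable {α β : Type*} [Fintype α] [Fintype β]
    (ρ : Matrix (α × β) (α × β) ℂ) : Prop :=
  ρ ∈ convexHull ℝ {τ : Matrix (α × β) (α × β) ℂ |
    ∃ (σ : Matrix α α ℂ) (ω : Matrix β β ℂ), IsState σ ∧ IsState ω ∧ τ = σ ⊗ₖ ω}

/-- The flip operator on two copies of a system with basis `α`: `F |a, a'⟩ = |a', a⟩`. -/
def flip (α : Type*) [DecidableEq α] : Matrix (α × α) (α × α) ℂ :=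
  Matrix.of fun r c => if r = (c.2, c.1) then 1 else 0

/-! ### Index sets

The standard basis of `(ℂ^d)^{⊗n}` is indexed by `Word n d`; the systems `A^n`, `B^n`, `A'^n`,
`B'^n` all have this basis. The basis of `A^n B^n` is `Word n d × Word n d` and the one of
`A^n B^n A'^n B'^n` is `(Word n d × Word n d) × (Word n d × Word n d)`. -/

/-- Basis labels of `(ℂ^d)^{⊗n}`. -/
abbrev Word (n d : ℕ) := Fin n → Fin d

/-- Basis labels of a single pair `AB`. -/
abbrev Pair (d : ℕ) := Fin d × Fin d

/-- Basis labels of a single group `A B A' B'`. -/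
abbrev Quad (d : ℕ) := Pair d × Pair d

/-- The labels of `A_i B_i` inside a label of `A^n B^n`. -/
def pairAt {n d : ℕ} (x : Word n d × Word n d) (i : Fin n) : Pair d := (x.1 i, x.2 i)

/-- The labels of `A_i B_i A'_i B'_i` inside a label of `A^n B^n A'^n B'^n`. -/
def quadAt {n d : ℕ} (x : (Word n d × Word n d) × (Word n d × Word n d)) (i : Fin n) : Quad d :=
  (pairAt x.1 i, pairAt x.2 i)

/-- Relabelling of the groups `A_i B_i A'_i B'_i` by a permutation of the index `i`. -/
def permute {n d : ℕ} (π : Equiv.Perm (Fin n))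
    (x : (Word n d × Word n d) × (Word n d × Word n d)) :
    (Word n d × Word n d) × (Word n d × Word n d) :=
  ((x.1.1 ∘ π, x.1.2 ∘ π), (x.2.1 ∘ π, x.2.2 ∘ π))

/-! ### The antisymmetric subspaces -/

/-- `∧²(ℂ^d)`, the antisymmetric subspace of `ℂ^d ⊗ ℂ^d`. -/
def wedge (d : ℕ) : Submodule ℂ (EuclideanSpace ℂ (Pair d)) where
  carrier := {v | ∀ a b, v (b, a) = -v (a, b)}
  add_mem' := by
    intro v w hv hw a b
    simp only [PiLp.add_apply, hv a b, hw a b]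
    ring
  zero_mem' := by
    intro a b
    simp
  smul_mem' := by
    intro c v hv a b
    simp only [PiLp.smul_apply, hv a b, smul_eq_mul]
    ring

/-- `(∧²(ℂ^d))^{⊗n}` as a subspace of `A^n B^n`: the span of the product vectors
`v_1 ⊗ ⋯ ⊗ v_n` with all `v_i ∈ ∧²(ℂ^d)`, `v_i` being a vector of `A_i B_i`. -/
def wedgePow (n d : ℕ) : Submodule ℂ (EuclideanSpace ℂ (Word n d × Word n d)) :=
  Submodule.span ℂ {ψ | ∃ v : Fin n → EuclideanSpace ℂ (Pair d),
    (∀ i, v i ∈ wedge d) ∧ ∀ x, ψ x = ∏ i, v i (pairAt x i)}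

/-- `∧²(ℂ^d) ⊗ ∧²(ℂ^d)` as a subspace of `A B A' B'`. -/
def wedgeTensorWedge (d : ℕ) : Submodule ℂ (EuclideanSpace ℂ (Quad d)) :=
  Submodule.span ℂ {u | ∃ v ∈ wedge d, ∃ w ∈ wedge d, ∀ x : Quad d, u x = v x.1 * w x.2}

/-! ### Irreducible representations of `U(d)` inside `∧² ⊗ ∧²` -/

/-- The operator `g^{⊗4}` on `A B A' B' = (ℂ^d)^{⊗4}`. -/
def tensorFour {d : ℕ} (g : Matrix (Fin d) (Fin d) ℂ) :
    EuclideanSpace ℂ (Quad d) →ₗ[ℂ] EuclideanSpace ℂ (Quad d) :=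
  Matrix.toEuclideanLin ((g ⊗ₖ g) ⊗ₖ (g ⊗ₖ g))

/-- `W` is stable under `g^{⊗4}` for all `g ∈ U(d)`. -/
def IsInvariant {d : ℕ} (W : Submodule ℂ (EuclideanSpace ℂ (Quad d))) : Prop :=
  ∀ g ∈ Matrix.unitaryGroup (Fin d) ℂ, ∀ v ∈ W, tensorFour g v ∈ W

/-- `W` is an irreducible subrepresentation of the representation `g ↦ g^{⊗4}` of `U(d)`. -/
def IsIrreducibleSubrep {d : ℕ} (W : Submodule ℂ (EuclideanSpace ℂ (Quad d))) : Prop :=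
  IsInvariant W ∧ W ≠ ⊥ ∧ ∀ W', IsInvariant W' → W' ≤ W → W' = ⊥ ∨ W' = W

/-- The three Young diagrams `1111`, `22`, `211`. -/
inductive Shape
  | s1111
  | s22
  | s211
  deriving DecidableEq

instance : Fintype Shape where
  elems := {.s1111, .s22, .s211}
  complete := by
    intro s
    cases s <;> decide

/-- The row lengths of the diagram, extended by zero. -/
def Shape.row : Shape → ℕ → ℕ
  | .s1111, i => [1, 1, 1, 1].getD i 0
  | .s22, i => [2, 2].getD i 0
  | .s211, i => [2, 1, 1].getD i 0

/-- `v` is a highest weight vector of weight `s`: a nonzero common eigenvector of the invertible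
upper triangular matrices `b` (acting by `b^{⊗4}`), with eigenvalue `∏ i, b i i ^ s_i`.
If the diagram has more than `d` rows there is no such vector: the eigenvalue of a scalar
matrix `t` would be a power of `t` other than `t ^ 4`. -/
def IsHighestWeightVector {d : ℕ} (s : Shape) (v : EuclideanSpace ℂ (Quad d)) : Prop :=
  v ≠ 0 ∧ ∀ b : Matrix (Fin d) (Fin d) ℂ, IsUnit b → (∀ i j, j < i → b i j = 0) →
    tensorFour b v = (∏ i : Fin d, b i i ^ s.row i) • v

/-- The component of `∧²(ℂ^d) ⊗ ∧²(ℂ^d)` of shape `s`: the sum of all irreducible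
subrepresentations with highest weight `s`. It is zero if the diagram has more than `d` rows. -/
def component (d : ℕ) (s : Shape) : Submodule ℂ (EuclideanSpace ℂ (Quad d)) :=
  sSup {W | W ≤ wedgeTensorWedge d ∧ IsIrreducibleSubrep W ∧ ∃ v ∈ W, IsHighestWeightVector s v}

/-- The matrix of the orthogonal projector onto the component of shape `s`. -/
def componentProj (d : ℕ) (s : Shape) : Matrix (Quad d) (Quad d) ℂ :=
  Matrix.toEuclideanLin.symm ((component d s).starProjection).toLinearMap

/-- The normalised projector `ρ_s` on `A B A' B'` (the zero matrix if the component is zero). -/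
def rho (d : ℕ) (s : Shape) : Matrix (Quad d) (Quad d) ℂ :=
  (componentProj d s).trace⁻¹ • componentProj d s

/-- `ρ_{y_1} ⊗ ⋯ ⊗ ρ_{y_n}`, the `i`-th factor acting on `A_i B_i A'_i B'_i`. -/
def rhoProd {n : ℕ} (d : ℕ) (y : Fin n → Shape) :
    Matrix ((Word n d × Word n d) × (Word n d × Word n d))
      ((Word n d × Word n d) × (Word n d × Word n d)) ℂ :=
  Matrix.of fun x z => ∏ i, rho d (y i) (quadAt x i) (quadAt z i)

/-! ### The two optimisation problems -/

/-- `tr ψ_{A^n}²` with `ψ_{A^n} = tr_{B^n} |ψ⟩⟨ψ|`. -/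
def purity {n d : ℕ} (ψ : EuclideanSpace ℂ (Word n d × Word n d)) : ℝ :=
  ((traceSecond (ketBra ψ) ^ 2).trace).re

/-- The reduced matrix on `A^n A'^n` of a matrix on `A^n B^n A'^n B'^n`. -/
def reduceAA {n d : ℕ} (Ω : Matrix ((Word n d × Word n d) × (Word n d × Word n d))
      ((Word n d × Word n d) × (Word n d × Word n d)) ℂ) :
    Matrix (Word n d × Word n d) (Word n d × Word n d) ℂ :=
  Matrix.of fun r c => ∑ b : Word n d, ∑ b' : Word n d,
    Ω ((r.1, b), (r.2, b')) ((c.1, b), (c.2, b'))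

/-- The objective `tr Ω_{A^n A'^n} F_{A^n : A'^n}`. -/
def flipValue {n d : ℕ} (Ω : Matrix ((Word n d × Word n d) × (Word n d × Word n d))
      ((Word n d × Word n d) × (Word n d × Word n d)) ℂ) : ℝ :=
  ((reduceAA Ω * flip (Word n d)).trace).re

/-- The feasible set of the second maximisation. As `Ω` has trace one, the weight of a word `y`
containing a shape that does not occur for this `d` is necessarily zero. -/
structure IsFeasible {n d : ℕ} (Ω : Matrix ((Word n d × Word n d) × (Word n d × Word n d))
      ((Word n d × Word n d) × (Word n d × Word n d)) ℂ) : Prop where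
  isState : IsState Ω
  mixture : ∃ p : (Fin n → Shape) → ℝ, (∀ y, 0 ≤ p y) ∧ ∑ y, p y = 1 ∧
    Ω = ∑ y, (p y : ℂ) • rhoProd d y
  separable : IsSeparable Ω
  perm_invariant : ∀ π : Equiv.Perm (Fin n), Ω.submatrix (permute π) (permute π) = Ω

end AntisymPurity

end

/-!
Write `∧²` for the antisymmetric subspace of a pair `A_i B_i`.

The second maximum is at most the first. A feasible `Ω` is separable, hence a convex combination of
projectors onto product vectors `φ ⊗ χ`. All its rows are antisymmetric in every pair, because the
`ρ_y` are, and the terms of the combination are positive, so the vectors of nonzero weight lie in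
`(∧²)^{⊗n}` themselves. With `a`, `b` the reductions of `φ`, `χ` to `A^n` and `A'^n`, the value of
the term is `tr (a b) ≤ (tr a² + tr b²) / 2`, which is at most the largest purity
(`IsFeasible.flipValue_le`).

Conversely, let `ψ` be a unit vector of `(∧²)^{⊗n}`. The value of `ψ ⊗ ψ` is the purity of `ψ`, but
this state need not be invariant. Consider the set of all product states of two unit vectors of
`(∧²)^{⊗n}` with that same value. Its convex hull is compact, consists of separable states, and is
mapped to itself by the local unitaries `g_1^{⊗4} ⊗ ⋯ ⊗ g_n^{⊗4}` and by the permutations of the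
sites. Instead of averaging over these groups, take the point of least Hilbert–Schmidt norm: it is
unique, hence fixed by all of them (`exists_fixed_point`). It remains to see that an invariant state
has the form required in the mixture condition (`exists_isFeasible`).

This is a statement about one site. Matrices that commute with `g^{⊗4}` for unitary `g` do so for
all `g`, by the Cayley transform and a polynomial identity (`commute_fourFold`). On `∧² ⊗ ∧²` such a
matrix is therefore a combination of the identity, the exchange of the two pairs and the sum of the
transpositions across them (`exists_eq_exchangeOp`). These three operators act as scalars on three
subspaces given by explicit symmetries of the coordinates, which span `∧² ⊗ ∧²`. Since projectors
onto invariant subspaces are in the commutant, the three subspaces are irreducible and pairwise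
orthogonal; comparing highest weight vectors identifies them with the components of highest weight
`1111`, `22` and `211` (`component_eq_shapeSpace`), so the commutant is spanned by the three
projectors (`IsSiteInvariant.eq_sum`). Applying this to one site after the other expands an
invariant state in the products of the `ρ_y` (`mem_span_prodMatrix`), with coefficients that are
its traces against products of projectors and hence form a probability distribution
(`exists_mixture`).
-/

open scoped Kronecker ComplexConjugate ComplexOrder

noncomputable section

namespace AntisymPurity

/-! ### Bi-antisymmetric vectors of one group -/

/-- The vector `(p ∧ q) ⊗ (r ∧ s)` of `∧² ⊗ ∧²`, without normalisation. -/
def wedgeVec {d : ℕ} (p q r s : Fin d → ℂ) : EuclideanSpace ℂ (Quad d) :=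
  WithLp.toLp 2 fun x => (p x.1.1 * q x.1.2 - q x.1.1 * p x.1.2) *
    (r x.2.1 * s x.2.2 - s x.2.1 * r x.2.2)

@[simp] lemma wedgeVec_apply {d : ℕ} (p q r s : Fin d → ℂ) (x : Quad d) :
    wedgeVec p q r s x = (p x.1.1 * q x.1.2 - q x.1.1 * p x.1.2) *
    (r x.2.1 * s x.2.2 - s x.2.1 * r x.2.2) := rfl

/-- The standard basis vector of `ℂ^d`. -/
def stdVec {d : ℕ} (i : Fin d) : Fin d → ℂ := fun j => if j = i then 1 else 0

/-- `(e_i ∧ e_j) ⊗ (e_k ∧ e_l)`. -/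
def wedgeBasis {d : ℕ} (i j k l : Fin d) : EuclideanSpace ℂ (Quad d) :=
  wedgeVec (stdVec i) (stdVec j) (stdVec k) (stdVec l)

lemma tensorFour_apply {d : ℕ} (g : Matrix (Fin d) (Fin d) ℂ) (v : EuclideanSpace ℂ (Quad d))
    (x : Quad d) : tensorFour g v x =
      ∑ z : Quad d, ((g x.1.1 z.1.1 * g x.1.2 z.1.2) * (g x.2.1 z.2.1 * g x.2.2 z.2.2)) * v z := by
  simp [tensorFour, Matrix.mulVec, dotProduct,
    Matrix.kroneckerMap_apply]

lemma tensorFour_wedgeVec {d : ℕ} (g : Matrix (Fin d) (Fin d) ℂ) (p q r s : Fin d → ℂ) :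
    tensorFour g (wedgeVec p q r s) =
      wedgeVec (g.mulVec p) (g.mulVec q) (g.mulVec r) (g.mulVec s) := by
  have key : ∀ (p q : Fin d → ℂ) (a b : Fin d),
      ∑ y : Pair d, (g a y.1 * g b y.2) * (p y.1 * q y.2 - q y.1 * p y.2) =
        g.mulVec p a * g.mulVec q b - g.mulVec q a * g.mulVec p b := by
    intro p q a b
    simp only [Matrix.mulVec, dotProduct, Finset.sum_mul_sum, Fintype.sum_prod_type,
      ← Finset.sum_sub_distrib]
    refine Finset.sum_congr rfl fun i _ => Finset.sum_congr rfl fun j _ => ?_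
    ring
  ext x
  rw [tensorFour_apply, wedgeVec_apply, ← key, ← key, Finset.sum_mul_sum,
    Fintype.sum_prod_type]
  refine Finset.sum_congr rfl fun i _ => Finset.sum_congr rfl fun j _ => ?_
  rw [wedgeVec_apply]
  ring

lemma mulVec_stdVec {d : ℕ} (g : Matrix (Fin d) (Fin d) ℂ) (i : Fin d) :
    g.mulVec (stdVec i) = fun j => g j i := by
  ext j
  simp [Matrix.mulVec, dotProduct, stdVec]

lemma wedgeVec_mem {d : ℕ} (p q r s : Fin d → ℂ) : wedgeVec p q r s ∈ wedgeTensorWedge d := by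
  refine Submodule.subset_span ⟨WithLp.toLp 2 fun x => p x.1 * q x.2 - q x.1 * p x.2, ?_,
    WithLp.toLp 2 fun x => r x.1 * s x.2 - s x.1 * r x.2, ?_, fun x => rfl⟩ <;>
  · intro a b
    simp only
    ring

/-- Antisymmetry inside each of the two pairs of letters: membership in `∧² ⊗ ∧²`, in
coordinates. -/
def IsBiAntisymm {d : ℕ} (v : Quad d → ℂ) : Prop :=
  (∀ a b y, v ((b, a), y) = -v ((a, b), y)) ∧ ∀ y a b, v (y, (b, a)) = -v (y, (a, b))

lemma IsBiAntisymm.eq_sum {d : ℕ} {v : EuclideanSpace ℂ (Quad d)} (hv : IsBiAntisymm v) :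
    v = (1 / 4 : ℂ) • ∑ x : Quad d, v x • wedgeBasis x.1.1 x.1.2 x.2.1 x.2.2 := by
  ext ⟨⟨a, b⟩, ⟨c, e⟩⟩
  simp only [PiLp.smul_apply, WithLp.ofLp_sum, Finset.sum_apply, wedgeBasis, wedgeVec_apply,
    stdVec, smul_eq_mul, Fintype.sum_prod_type]
  have h2 : ∀ (a b c e : Fin d), (∑ i, ∑ j, ∑ k, ∑ l, (if a = i then (1 : ℂ) else 0) *
      ((if b = j then 1 else 0) * ((if c = k then 1 else 0) * ((if e = l then 1 else 0) *
        v ((i, j), (k, l)))))) = v ((a, b), (c, e)) := by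
    intro a b c e
    simp only [← Finset.mul_sum]
    simp only [ite_mul, one_mul, zero_mul, Finset.sum_ite_eq, Finset.mem_univ,
      if_true]
  have h1 : ∀ i j k l : Fin d, v ((i, j), (k, l)) *
      (((if a = i then (1:ℂ) else 0) * (if b = j then 1 else 0)
        - (if a = j then 1 else 0) * (if b = i then 1 else 0)) *
       ((if c = k then 1 else 0) * (if e = l then 1 else 0)
        - (if c = l then 1 else 0) * (if e = k then 1 else 0))) =
      (if a = i then (1 : ℂ) else 0) * ((if b = j then 1 else 0) * ((if c = k then 1 else 0) *
        ((if e = l then 1 else 0) * v ((i, j), (k, l)))))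
      - (if a = i then (1 : ℂ) else 0) * ((if b = j then 1 else 0) * ((if e = k then 1 else 0) *
        ((if c = l then 1 else 0) * v ((i, j), (k, l)))))
      - (if b = i then (1 : ℂ) else 0) * ((if a = j then 1 else 0) * ((if c = k then 1 else 0) *
        ((if e = l then 1 else 0) * v ((i, j), (k, l)))))
      + (if b = i then (1 : ℂ) else 0) * ((if a = j then 1 else 0) * ((if e = k then 1 else 0) *
        ((if c = l then 1 else 0) * v ((i, j), (k, l))))) := by
    intro i j k l
    ring
  simp only [h1, Finset.sum_add_distrib,
    Finset.sum_sub_distrib]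
  rw [h2, h2, h2, h2, hv.2 (b, a) c e, hv.1 a b, hv.2 (a, b) c e]
  ring

lemma mem_wedgeTensorWedge {d : ℕ} {v : EuclideanSpace ℂ (Quad d)} :
    v ∈ wedgeTensorWedge d ↔ IsBiAntisymm v := by
  constructor
  · intro hv
    induction hv using Submodule.span_induction with
    | mem u hu =>
      obtain ⟨v, hv, w, hw, h⟩ := hu
      refine ⟨fun a b y => ?_, fun y a b => ?_⟩
      · rw [h, h, hv a b]
        ring
      · rw [h, h, hw a b]
        ring
    | zero => exact ⟨by simp, by simp⟩
    | add u w _ _ hu hw =>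
      refine ⟨fun a b y => ?_, fun y a b => ?_⟩
      · simp only [PiLp.add_apply, hu.1 a b, hw.1 a b]
        ring
      · simp only [PiLp.add_apply, hu.2 y a b, hw.2 y a b]
        ring
    | smul c u _ hu =>
      refine ⟨fun a b y => ?_, fun y a b => ?_⟩
      · simp only [PiLp.smul_apply, hu.1 a b, smul_eq_mul]
        ring
      · simp only [PiLp.smul_apply, hu.2 y a b, smul_eq_mul]
        ring
  · intro hv
    rw [hv.eq_sum]
    exact Submodule.smul_mem _ _ (Submodule.sum_mem _ fun x _ =>
      Submodule.smul_mem _ _ (wedgeVec_mem _ _ _ _))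

/-! ### From unitary to arbitrary matrices -/

/-- The operator `g^{⊗4}` as a matrix. -/
abbrev fourFold {d : ℕ} (g : Matrix (Fin d) (Fin d) ℂ) : Matrix (Quad d) (Quad d) ℂ :=
  (g ⊗ₖ g) ⊗ₖ (g ⊗ₖ g)

lemma fourFold_smul {d : ℕ} (c : ℂ) (g : Matrix (Fin d) (Fin d) ℂ) :
    fourFold (c • g) = c ^ 4 • fourFold g := by
  ext x z
  simp only [fourFold, Matrix.kroneckerMap_apply, Matrix.smul_apply, smul_eq_mul]
  ring

lemma fourFold_map {d : ℕ} {R : Type*} [CommRing R] (f : R →+* ℂ) (g : Matrix (Fin d) (Fin d) R) :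
    fourFold (g.map f) = ((g ⊗ₖ g) ⊗ₖ (g ⊗ₖ g)).map f := by
  ext x z
  simp [Matrix.kroneckerMap_apply]

open Polynomial in
/-- If `X` commutes with `g^{⊗4}` for all unitary `g`, it does so for all matrices: the Cayley
transform `(1 + K)(1 - K)⁻¹` of `K = A + zB`, with `A` and `B` skew-Hermitian, is unitary for real
`z`, and after clearing the denominator the commutator is polynomial in `z`, hence vanishes at
`z = i`, where `K` is arbitrary. -/
theorem commute_fourFold {d : ℕ} {X : Matrix (Quad d) (Quad d) ℂ}
    (hX : ∀ g ∈ Matrix.unitaryGroup (Fin d) ℂ, X * fourFold g = fourFold g * X)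
    (M : Matrix (Fin d) (Fin d) ℂ) : X * fourFold M = fourFold M * X := by
  -- the skew-Hermitian case, without inverses
  have hskew : ∀ K : Matrix (Fin d) (Fin d) ℂ, K.conjTranspose = -K →
      X * fourFold ((1 + K) * (1 - K).adjugate) = fourFold ((1 + K) * (1 - K).adjugate) * X := by
    intro K hK
    by_cases hdet : (1 - K).det = 0
    · -- impossible, since a skew-Hermitian matrix has no eigenvalue `1`
      exfalso
      obtain ⟨v, hv0, hv⟩ := Matrix.exists_mulVec_eq_zero_iff.mpr hdet
      have h1 : K.mulVec v = v := by
        rw [Matrix.sub_mulVec, Matrix.one_mulVec, sub_eq_zero] at hv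
        exact hv.symm
      have h2 : star v ⬝ᵥ K.mulVec v = star (K.conjTranspose.mulVec v) ⬝ᵥ v := by
        rw [Matrix.star_mulVec, Matrix.conjTranspose_conjTranspose, Matrix.dotProduct_mulVec]
      rw [hK, Matrix.neg_mulVec, h1, star_neg, neg_dotProduct] at h2
      exact hv0 (dotProduct_star_self_eq_zero.mp (self_eq_neg.mp h2))
    · have hu : IsUnit (1 - K).det := isUnit_iff_ne_zero.mpr hdet
      have hc : (1 - K).conjTranspose = 1 + K := by
        rw [Matrix.conjTranspose_sub, hK, Matrix.conjTranspose_one, sub_neg_eq_add]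
      have hc' : (1 + K).conjTranspose = 1 - K := by
        rw [Matrix.conjTranspose_add, hK, Matrix.conjTranspose_one, sub_eq_add_neg]
      have hcomm : (1 + K) * (1 - K) = (1 - K) * (1 + K) := by noncomm_ring
      have hu' : IsUnit (1 + K).det := by
        rw [← hc, Matrix.det_conjTranspose]
        exact hu.star
      have hg : (1 + K) * (1 - K)⁻¹ ∈ Matrix.unitaryGroup (Fin d) ℂ := by
        rw [Matrix.mem_unitaryGroup_iff', Matrix.star_eq_conjTranspose,
          Matrix.conjTranspose_mul, Matrix.conjTranspose_nonsing_inv, hc, hc']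
        calc (1 + K)⁻¹ * (1 - K) * ((1 + K) * (1 - K)⁻¹)
            = (1 + K)⁻¹ * ((1 - K) * (1 + K)) * (1 - K)⁻¹ := by simp only [Matrix.mul_assoc]
          _ = (1 + K)⁻¹ * (1 + K) * ((1 - K) * (1 - K)⁻¹) := by
              rw [← hcomm]; simp only [Matrix.mul_assoc]
          _ = 1 := by rw [Matrix.nonsing_inv_mul _ hu', Matrix.mul_nonsing_inv _ hu, mul_one]
      have hadj : (1 + K) * (1 - K).adjugate = (1 - K).det • ((1 + K) * (1 - K)⁻¹) := by
        rw [Matrix.inv_def, Ring.inverse_eq_inv', Matrix.mul_smul, smul_smul,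
          mul_inv_cancel₀ hdet, one_smul]
      rw [hadj, fourFold_smul, Matrix.mul_smul, Matrix.smul_mul, hX _ hg]
  have hall : ∀ K : Matrix (Fin d) (Fin d) ℂ,
      X * fourFold ((1 + K) * (1 - K).adjugate) = fourFold ((1 + K) * (1 - K).adjugate) * X := by
    intro K
    set A : Matrix (Fin d) (Fin d) ℂ := (1 / 2 : ℂ) • (K - K.conjTranspose) with hA
    set B : Matrix (Fin d) (Fin d) ℂ := (-Complex.I / 2) • (K + K.conjTranspose) with hB
    have hAs : A.conjTranspose = -A := by
      rw [hA, Matrix.conjTranspose_smul, Matrix.conjTranspose_sub,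
        Matrix.conjTranspose_conjTranspose, ← smul_neg, neg_sub]
      congr 1
      simp
    have hBs : B.conjTranspose = -B := by
      rw [hB, Matrix.conjTranspose_smul, Matrix.conjTranspose_add,
        Matrix.conjTranspose_conjTranspose, ← neg_smul, add_comm]
      congr 1
      simp [neg_div]
    have hABK : A + Complex.I • B = K := by
      rw [hA, hB, smul_smul]
      have : Complex.I * (-Complex.I / 2) = 1 / 2 := by
        rw [mul_div_assoc', mul_neg, Complex.I_mul_I, neg_neg]
      rw [this, ← smul_add, sub_add_add_cancel, ← two_smul ℂ K, smul_smul]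
      norm_num
    -- the polynomial family `A + zB`
    let Kp : Matrix (Fin d) (Fin d) ℂ[X] := A.map Polynomial.C + (Polynomial.X : ℂ[X]) •
      B.map Polynomial.C
    let Np : Matrix (Fin d) (Fin d) ℂ[X] := (1 + Kp) * (1 - Kp).adjugate
    let Fp : Matrix (Quad d) (Quad d) ℂ[X] :=
      X.map Polynomial.C * ((Np ⊗ₖ Np) ⊗ₖ (Np ⊗ₖ Np)) -
        ((Np ⊗ₖ Np) ⊗ₖ (Np ⊗ₖ Np)) * X.map Polynomial.C
    have hKz : ∀ z : ℂ, Kp.map (Polynomial.evalRingHom z) = A + z • B := by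
      intro z
      ext i j
      simp [Kp, mul_comm z]
    have hNz : ∀ z : ℂ, Np.map (Polynomial.evalRingHom z) =
        (1 + (A + z • B)) * (1 - (A + z • B)).adjugate := by
      intro z
      have h1 : (1 + Kp).map (Polynomial.evalRingHom z) = 1 + (A + z • B) := by
        rw [← hKz]
        exact map_add (Polynomial.evalRingHom z).mapMatrix 1 Kp |>.trans (by rw [map_one]; rfl)
      have h2 : (1 - Kp).map (Polynomial.evalRingHom z) = 1 - (A + z • B) := by
        rw [← hKz]
        exact map_sub (Polynomial.evalRingHom z).mapMatrix 1 Kp |>.trans (by rw [map_one]; rfl)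
      rw [← h1, ← h2]
      have h3 := RingHom.map_adjugate (Polynomial.evalRingHom z) (1 - Kp)
      rw [Matrix.map_mul, show (1 - Kp).adjugate.map (Polynomial.evalRingHom z) = _ from h3]
      rfl
    have hFz : ∀ z : ℂ, Fp.map (Polynomial.evalRingHom z) =
        X * fourFold ((1 + (A + z • B)) * (1 - (A + z • B)).adjugate) -
        fourFold ((1 + (A + z • B)) * (1 - (A + z • B)).adjugate) * X := by
      intro z
      have hXC : (X.map Polynomial.C).map (Polynomial.evalRingHom z) = X := by
        ext i j
        simp
      rw [← hNz, fourFold_map]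
      conv_rhs => rw [← hXC]
      rw [← Matrix.map_mul, ← Matrix.map_mul]
      exact Matrix.map_sub _ (fun a b => map_sub _ a b) _ _
    have hreal : ∀ t : ℝ, Fp.map (Polynomial.evalRingHom (t : ℂ)) = 0 := by
      intro t
      rw [hFz, sub_eq_zero]
      refine hskew _ ?_
      rw [Matrix.conjTranspose_add, hAs, Matrix.conjTranspose_smul, hBs, neg_add, smul_neg]
      simp
    have hzero : ∀ i j, Fp i j = 0 := by
      intro i j
      refine Polynomial.eq_zero_of_infinite_isRoot _ (Set.infinite_of_injective_forall_mem
        Complex.ofReal_injective fun t => ?_)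
      have := congrFun (congrFun (hreal t) i) j
      simpa using this
    have hI : Fp.map (Polynomial.evalRingHom Complex.I) = 0 := by
      ext i j
      simp [hzero i j]
    rwa [hFz, hABK, sub_eq_zero] at hI
  -- a scalar multiple of `M` without the eigenvalue `-1` is a Cayley transform
  obtain ⟨c, hc0, hc⟩ : ∃ c : ℂ, c ≠ 0 ∧ (1 + c • M).det ≠ 0 := by
    let Q : Matrix (Fin d) (Fin d) ℂ[X] := 1 + (Polynomial.X : ℂ[X]) • M.map Polynomial.C
    have hQ : ∀ z : ℂ, Q.det.eval z = (1 + z • M).det := by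
      intro z
      rw [← Polynomial.coe_evalRingHom, RingHom.map_det]
      congr 1
      ext i j
      by_cases hij : i = j <;> simp [Q, hij, mul_comm z]
    have hQ0 : Q.det ≠ 0 := by
      intro h
      have := hQ 0
      rw [h] at this
      simp at this
    have hfin : {z : ℂ | (Q.det * Polynomial.X).IsRoot z}.Finite :=
      Polynomial.finite_setOfPred_isRoot (mul_ne_zero hQ0 Polynomial.X_ne_zero)
    obtain ⟨c, hc⟩ := hfin.infinite_compl.nonempty
    simp only [Set.mem_compl_iff, Set.mem_ofPred_eq, Polynomial.IsRoot, Polynomial.eval_mul,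
      Polynomial.eval_X, mul_eq_zero, not_or, hQ] at hc
    exact ⟨c, hc.2, hc.1⟩
  set T := 1 + c • M with hT
  have hTu : IsUnit T.det := isUnit_iff_ne_zero.mpr hc
  have hcM : c • M = T - 1 := by rw [hT, add_sub_cancel_left]
  have hm : 1 - (c • M - 1) * T⁻¹ = (2 : ℂ) • T⁻¹ := by
    rw [hcM, sub_sub, sub_mul, Matrix.mul_nonsing_inv _ hTu, two_smul]
    noncomm_ring
  have hp : 1 + (c • M - 1) * T⁻¹ = (2 : ℂ) • (c • M) * T⁻¹ := by
    have h1 : (1 : Matrix (Fin d) (Fin d) ℂ) = T * T⁻¹ := (Matrix.mul_nonsing_inv _ hTu).symm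
    nth_rewrite 1 [h1]
    rw [← add_mul, two_smul, hcM, show T + (T - 1 - 1) = T - 1 + (T - 1) by abel]
  have key := hall ((c • M - 1) * T⁻¹)
  have hadj : (1 + (c • M - 1) * T⁻¹) * (1 - (c • M - 1) * T⁻¹).adjugate =
      (((2 : ℂ) • T⁻¹).det * c) • M := by
    have hdu : IsUnit ((2 : ℂ) • T⁻¹).det := by
      rw [Matrix.det_smul]
      exact (IsUnit.pow _ (isUnit_iff_ne_zero.mpr two_ne_zero)).mul
        (Matrix.isUnit_nonsing_inv_det _ hTu)
    have h2 : (1 + (c • M - 1) * T⁻¹) = (c • M) * ((2 : ℂ) • T⁻¹) := by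
      rw [hp, Matrix.mul_smul, Matrix.smul_mul]
    rw [hm, h2, Matrix.mul_assoc, Matrix.mul_adjugate, Matrix.mul_smul, mul_one, smul_smul]
  have hne : ((2 : ℂ) • T⁻¹).det * c ≠ 0 := by
    refine mul_ne_zero ?_ hc0
    rw [Matrix.det_smul]
    exact mul_ne_zero (pow_ne_zero _ two_ne_zero)
      (Matrix.isUnit_nonsing_inv_det _ hTu).ne_zero
  rw [hadj, fourFold_smul, Matrix.mul_smul, Matrix.smul_mul] at key
  exact smul_right_injective _ (pow_ne_zero 4 hne) key

/-! ### Weights -/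

/-- How often the letter `m` occurs among the four letters of a label. -/
def letterCount {d : ℕ} (m : Fin d) (x : Quad d) : ℕ :=
  (if x.1.1 = m then 1 else 0) + (if x.1.2 = m then 1 else 0) +
    ((if x.2.1 = m then 1 else 0) + (if x.2.2 = m then 1 else 0))

/-- The diagonal matrix with entry `2` at `m` and `1` elsewhere. Its fourfold tensor power
separates labels by their `letterCount`. -/
def doubling {d : ℕ} (m : Fin d) : Matrix (Fin d) (Fin d) ℂ :=
  Matrix.diagonal fun a => if a = m then 2 else 1

lemma tensorFour_doubling {d : ℕ} (m : Fin d) (v : EuclideanSpace ℂ (Quad d)) (x : Quad d) :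
    tensorFour (doubling m) v x = 2 ^ letterCount m x * v x := by
  rw [tensorFour_apply, Finset.sum_eq_single x]
  · simp only [doubling, Matrix.diagonal_apply_eq, letterCount, pow_add]
    congr 1
    congr 1 <;> congr 1 <;> split_ifs <;> simp
  · intro z _ hz
    have : ¬(x.1.1 = z.1.1 ∧ x.1.2 = z.1.2 ∧ x.2.1 = z.2.1 ∧ x.2.2 = z.2.2) := by
      rintro ⟨h1, h2, h3, h4⟩
      exact hz (Prod.ext (Prod.ext h1.symm h2.symm) (Prod.ext h3.symm h4.symm))
    simp only [doubling, Matrix.diagonal_apply]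
    split_ifs <;> simp_all
  · simp

lemma letterCount_eq_of_doubling {d : ℕ} {m : Fin d} {v : EuclideanSpace ℂ (Quad d)} {k : ℕ}
    (h : tensorFour (doubling m) v = (2 ^ k : ℂ) • v) {x : Quad d} (hx : v x ≠ 0) :
    letterCount m x = k := by
  have h1 := congrArg (fun w : EuclideanSpace ℂ (Quad d) => w x) h
  simp only [tensorFour_doubling, PiLp.smul_apply, smul_eq_mul] at h1
  have h2 := mul_right_cancel₀ hx h1
  have h3 : (2 : ℕ) ^ letterCount m x = 2 ^ k := by exact_mod_cast h2
  exact Nat.pow_right_injective le_rfl h3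

/-- `v` is supported on the rearrangements of the label `x₀`. -/
def SupportedOn {d : ℕ} (v : Quad d → ℂ) (x₀ : Quad d) : Prop :=
  ∀ x, v x ≠ 0 → ∀ m, letterCount m x = letterCount m x₀

lemma stdVec_wedge_ne_zero {d : ℕ} {i j a b : Fin d}
    (h : stdVec i a * stdVec j b - stdVec j a * stdVec i b ≠ 0) :
    (a = i ∧ b = j) ∨ (a = j ∧ b = i) := by
  by_contra hn
  apply h
  simp only [stdVec]
  split_ifs <;> simp_all

lemma wedgeBasis_supportedOn {d : ℕ} (i j k l : Fin d) :
    SupportedOn (wedgeBasis i j k l) ((i, j), (k, l)) := by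
  rintro ⟨⟨a, b⟩, ⟨c, e⟩⟩ hx m
  have h1 := stdVec_wedge_ne_zero (left_ne_zero_of_mul hx)
  have h2 := stdVec_wedge_ne_zero (right_ne_zero_of_mul hx)
  simp only [letterCount]
  rcases h1 with ⟨h, h'⟩ | ⟨h, h'⟩ <;> rcases h2 with ⟨h'', h'''⟩ | ⟨h'', h'''⟩ <;>
    simp only at h h' h'' h''' <;> subst h h' h'' h''' <;> ring

lemma tensorFour_doubling_wedgeBasis {d : ℕ} (m i j k l : Fin d) :
    tensorFour (doubling m) (wedgeBasis i j k l) =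
      (2 ^ letterCount m ((i, j), (k, l)) : ℂ) • wedgeBasis i j k l := by
  ext x
  rw [tensorFour_doubling, PiLp.smul_apply, smul_eq_mul]
  by_cases hx : wedgeBasis i j k l x = 0
  · rw [hx, mul_zero, mul_zero]
  · rw [wedgeBasis_supportedOn i j k l x hx m]

lemma SupportedOn.sub {d : ℕ} {v w : EuclideanSpace ℂ (Quad d)} {x₀ : Quad d}
    (hv : SupportedOn v x₀) (hw : SupportedOn w x₀) : SupportedOn (v - w) x₀ := by
  intro x hx
  by_cases h : v x = 0
  · refine hw x fun h' => hx ?_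
    simp [h, h']
  · exact hv x h

lemma SupportedOn.add {d : ℕ} {v w : EuclideanSpace ℂ (Quad d)} {x₀ : Quad d}
    (hv : SupportedOn v x₀) (hw : SupportedOn w x₀) : SupportedOn (v + w) x₀ := by
  intro x hx
  by_cases h : v x = 0
  · refine hw x fun h' => hx ?_
    simp [h, h']
  · exact hv x h

lemma SupportedOn.smul {d : ℕ} {v : EuclideanSpace ℂ (Quad d)} {x₀ : Quad d}
    (hv : SupportedOn v x₀) (c : ℂ) : SupportedOn (c • v) x₀ := by
  intro x hx
  refine hv x fun h => hx ?_
  simp [h]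

lemma SupportedOn.rearrange {d : ℕ} {v : Quad d → ℂ} {x₀ x₁ : Quad d}
    (hv : SupportedOn v x₀) (h : ∀ m, letterCount m x₀ = letterCount m x₁) : SupportedOn v x₁ :=
  fun x hx m => (hv x hx m).trans (h m)

lemma eq_of_wedge {d : ℕ} {v w : EuclideanSpace ℂ (Quad d)} {x₀ : Quad d}
    (hv : IsBiAntisymm v) (hw : IsBiAntisymm w) (hvs : SupportedOn v x₀) (hws : SupportedOn w x₀)
    (h : ∀ r : EuclideanSpace ℂ (Quad d), IsBiAntisymm r → SupportedOn r x₀ →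
      (∀ x, v x = w x → r x = 0) → r = 0) : v = w := by
  refine sub_eq_zero.mp (h (v - w) ?_ (hvs.sub hws) ?_)
  · rw [← mem_wedgeTensorWedge] at *
    exact Submodule.sub_mem _ hv hw
  · intro x hx
    simp [hx]

/-- A bi-antisymmetric function that vanishes at `(i j | i j)` vanishes at all rearrangements of
this label: two equal letters cannot share a pair, so only the order inside the pairs can change. -/
lemma eq_zero_of_letterCount_two {d : ℕ} {f : Quad d → ℂ} (hf : IsBiAntisymm f) {i j : Fin d}
    (hij : i ≠ j) (h0 : f ((i, j), (i, j)) = 0) {a b c e : Fin d}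
    (h : ∀ m, letterCount m ((a, b), (c, e)) = letterCount m ((i, j), (i, j))) :
    f ((a, b), (c, e)) = 0 := by
  by_contra hne
  have hab : a ≠ b := by
    rintro rfl
    exact hne (self_eq_neg.mp (hf.1 a a _))
  have hce : c ≠ e := by
    rintro rfl
    exact hne (self_eq_neg.mp (hf.2 _ c c))
  have h1 := h i
  have h2 := h j
  obtain ⟨h3, h4⟩ := hf
  simp only [letterCount, hij, hij.symm, if_true, if_false] at h1 h2
  clear h
  grind

lemma eq_zero_of_letterCount_three {d : ℕ} {f : Quad d → ℂ} (hf : IsBiAntisymm f) {i j k : Fin d}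
    (hij : i ≠ j) (hik : i ≠ k) (hjk : j ≠ k) (h0 : f ((i, j), (i, k)) = 0)
    (h0' : f ((i, k), (i, j)) = 0) {a b c e : Fin d}
    (h : ∀ m, letterCount m ((a, b), (c, e)) = letterCount m ((i, j), (i, k))) :
    f ((a, b), (c, e)) = 0 := by
  by_contra hne
  have hab : a ≠ b := by
    rintro rfl
    exact hne (self_eq_neg.mp (hf.1 a a _))
  have hce : c ≠ e := by
    rintro rfl
    exact hne (self_eq_neg.mp (hf.2 _ c c))
  have h1 := h i
  have h2 := h j
  have h5 := h k
  obtain ⟨h3, h4⟩ := hf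
  simp only [letterCount, hij, hij.symm, hik, hik.symm, hjk, hjk.symm, if_true, if_false]
    at h1 h2 h5
  clear h
  grind

lemma eq_zero_of_letterCount_four {d : ℕ} {f : Quad d → ℂ} (hf : IsBiAntisymm f)
    {i j k l : Fin d} (hij : i ≠ j) (hik : i ≠ k) (hil : i ≠ l) (hjk : j ≠ k) (hjl : j ≠ l)
    (hkl : k ≠ l) (e1 : f ((i, j), (k, l)) = 0) (e2 : f ((k, l), (i, j)) = 0)
    (e3 : f ((i, k), (j, l)) = 0) (e4 : f ((j, l), (i, k)) = 0) (e5 : f ((i, l), (j, k)) = 0)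
    (e6 : f ((j, k), (i, l)) = 0) {a b c e : Fin d}
    (h : ∀ m, letterCount m ((a, b), (c, e)) = letterCount m ((i, j), (k, l))) :
    f ((a, b), (c, e)) = 0 := by
  have h1 := h i
  have h2 := h j
  have h5 := h k
  have h6 := h l
  obtain ⟨h3, h4⟩ := hf
  simp only [letterCount, hij, hij.symm, hik, hik.symm, hjk, hjk.symm, hil, hil.symm, hjl,
    hjl.symm, hkl, hkl.symm, if_true, if_false] at h1 h2 h5 h6
  clear h
  grind

/-- A vector with weight of type `(2, 2)` is a multiple of `(e_i ∧ e_j) ⊗ (e_i ∧ e_j)`. -/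
lemma eq_of_supportedOn_two {d : ℕ} {v : EuclideanSpace ℂ (Quad d)} (hv : IsBiAntisymm v)
    {i j : Fin d} (hij : i ≠ j) (hs : SupportedOn v ((i, j), (i, j))) :
    v = v ((i, j), (i, j)) • wedgeBasis i j i j := by
  refine eq_of_wedge hv ?_ hs ((wedgeBasis_supportedOn i j i j).smul _) ?_
  · exact mem_wedgeTensorWedge.mp (Submodule.smul_mem _ _ (wedgeVec_mem _ _ _ _))
  · intro r hr hrs hr0
    have h0 : r ((i, j), (i, j)) = 0 := hr0 _ (by simp [wedgeBasis, stdVec, hij, hij.symm])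
    ext ⟨⟨a, b⟩, ⟨c, e⟩⟩
    by_contra hne
    exact hne (eq_zero_of_letterCount_two hr hij h0 (hrs _ hne))

/-- A vector with weight of type `(2, 1, 1)`. -/
lemma eq_of_supportedOn_three {d : ℕ} {v : EuclideanSpace ℂ (Quad d)} (hv : IsBiAntisymm v)
    {i j k : Fin d} (hij : i ≠ j) (hik : i ≠ k) (hjk : j ≠ k)
    (hs : SupportedOn v ((i, j), (i, k))) :
    v = v ((i, j), (i, k)) • wedgeBasis i j i k + v ((i, k), (i, j)) • wedgeBasis i k i j := by
  refine eq_of_wedge hv ?_ hs (((wedgeBasis_supportedOn i j i k).smul _).add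
    (((wedgeBasis_supportedOn i k i j).rearrange ?_).smul _)) ?_
  · exact mem_wedgeTensorWedge.mp (Submodule.add_mem _
      (Submodule.smul_mem _ _ (wedgeVec_mem _ _ _ _))
      (Submodule.smul_mem _ _ (wedgeVec_mem _ _ _ _)))
  · intro m
    simp only [letterCount]
    ring
  · intro r hr hrs hr0
    have h0 : r ((i, j), (i, k)) = 0 := hr0 _ (by
      simp [wedgeBasis, stdVec, hij, hij.symm, hik, hik.symm, hjk, hjk.symm])
    have h0' : r ((i, k), (i, j)) = 0 := hr0 _ (by
      simp [wedgeBasis, stdVec, hij, hij.symm, hik, hik.symm, hjk, hjk.symm])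
    ext ⟨⟨a, b⟩, ⟨c, e⟩⟩
    by_contra hne
    exact hne (eq_zero_of_letterCount_three hr hij hik hjk h0 h0' (hrs _ hne))

/-- A vector with weight of type `(1, 1, 1, 1)`. -/
lemma eq_of_supportedOn_four {d : ℕ} {v : EuclideanSpace ℂ (Quad d)} (hv : IsBiAntisymm v)
    {i j k l : Fin d} (hij : i ≠ j) (hik : i ≠ k) (hil : i ≠ l) (hjk : j ≠ k) (hjl : j ≠ l)
    (hkl : k ≠ l) (hs : SupportedOn v ((i, j), (k, l))) :
    v = v ((i, j), (k, l)) • wedgeBasis i j k l + v ((k, l), (i, j)) • wedgeBasis k l i j +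
      v ((i, k), (j, l)) • wedgeBasis i k j l + v ((j, l), (i, k)) • wedgeBasis j l i k +
      v ((i, l), (j, k)) • wedgeBasis i l j k + v ((j, k), (i, l)) • wedgeBasis j k i l := by
  refine eq_of_wedge hv ?_ hs ((((((wedgeBasis_supportedOn i j k l).smul _).add
    (((wedgeBasis_supportedOn k l i j).rearrange ?_).smul _)).add
    (((wedgeBasis_supportedOn i k j l).rearrange ?_).smul _)).add
    (((wedgeBasis_supportedOn j l i k).rearrange ?_).smul _)).add
    (((wedgeBasis_supportedOn i l j k).rearrange ?_).smul _) |>.add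
    (((wedgeBasis_supportedOn j k i l).rearrange ?_).smul _)) ?_
  · refine mem_wedgeTensorWedge.mp (Submodule.add_mem _ (Submodule.add_mem _ (Submodule.add_mem _
      (Submodule.add_mem _ (Submodule.add_mem _ ?_ ?_) ?_) ?_) ?_) ?_) <;>
    exact Submodule.smul_mem _ _ (wedgeVec_mem _ _ _ _)
  · intro m; simp only [letterCount]; ring
  · intro m; simp only [letterCount]; ring
  · intro m; simp only [letterCount]; ring
  · intro m; simp only [letterCount]; ring
  · intro m; simp only [letterCount]; ring
  · intro r hr hrs hr0
    have e1 : r ((i, j), (k, l)) = 0 := hr0 _ (by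
      simp [wedgeBasis, stdVec, hij, hij.symm, hik, hik.symm, hjk, hjk.symm,
        hil, hil.symm, hjl, hjl.symm, hkl, hkl.symm])
    have e2 : r ((k, l), (i, j)) = 0 := hr0 _ (by
      simp [wedgeBasis, stdVec, hij, hij.symm, hik, hik.symm, hjk, hjk.symm,
        hil, hil.symm, hjl, hjl.symm, hkl, hkl.symm])
    have e3 : r ((i, k), (j, l)) = 0 := hr0 _ (by
      simp [wedgeBasis, stdVec, hij, hij.symm, hik, hik.symm, hjk, hjk.symm,
        hil, hil.symm, hjl, hjl.symm, hkl, hkl.symm])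
    have e4 : r ((j, l), (i, k)) = 0 := hr0 _ (by
      simp [wedgeBasis, stdVec, hij, hij.symm, hik, hik.symm, hjk, hjk.symm,
        hil, hil.symm, hjl, hjl.symm, hkl, hkl.symm])
    have e5 : r ((i, l), (j, k)) = 0 := hr0 _ (by
      simp [wedgeBasis, stdVec, hij, hij.symm, hik, hik.symm, hjk, hjk.symm,
        hil, hil.symm, hjl, hjl.symm, hkl, hkl.symm])
    have e6 : r ((j, k), (i, l)) = 0 := hr0 _ (by
      simp [wedgeBasis, stdVec, hij, hij.symm, hik, hik.symm, hjk, hjk.symm,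
        hil, hil.symm, hjl, hjl.symm, hkl, hkl.symm])
    ext ⟨⟨a, b⟩, ⟨c, e⟩⟩
    by_contra hne
    exact hne (eq_zero_of_letterCount_four hr hij hik hil hjk hjl hkl
      e1 e2 e3 e4 e5 e6 (hrs _ hne))

/-! ### The commutant on `∧² ⊗ ∧²` -/

/-- The operator `α + β S + γ G` on `A B A' B'`, where `S` exchanges the pairs `AB` and `A'B'`, and
`G` acts on `∧² ⊗ ∧²` as the sum of the four transpositions of a letter of `AB` with a letter of
`A'B'`. The letters are arranged so that the image of a vector of `∧² ⊗ ∧²` is visibly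
antisymmetric in each pair. -/
def exchangeOp (d : ℕ) (α β γ : ℂ) :
    EuclideanSpace ℂ (Quad d) →ₗ[ℂ] EuclideanSpace ℂ (Quad d) where
  toFun v := WithLp.toLp 2 fun x => α * v x + β * v (x.2, x.1) +
    γ * (v ((x.1.1, x.2.1), (x.1.2, x.2.2)) + v ((x.1.2, x.2.2), (x.1.1, x.2.1)) -
      v ((x.1.2, x.2.1), (x.1.1, x.2.2)) - v ((x.1.1, x.2.2), (x.1.2, x.2.1)))
  map_add' v w := by
    ext x
    simp only [PiLp.add_apply]
    ring
  map_smul' c v := by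
    ext x
    simp only [PiLp.smul_apply, smul_eq_mul, RingHom.id_apply]
    ring

lemma exchangeOp_apply {d : ℕ} (α β γ : ℂ) (v : EuclideanSpace ℂ (Quad d)) (a b c e : Fin d) :
    exchangeOp d α β γ v ((a, b), (c, e)) = α * v ((a, b), (c, e)) + β * v ((c, e), (a, b)) +
    γ * (v ((a, c), (b, e)) + v ((b, e), (a, c)) - v ((b, c), (a, e)) - v ((a, e), (b, c))) := rfl

lemma exchangeOp_wedgeBasis {d : ℕ} (α β γ : ℂ) (i j k l : Fin d) :
    exchangeOp d α β γ (wedgeBasis i j k l) = α • wedgeBasis i j k l + β • wedgeBasis k l i j +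
      γ • (wedgeBasis i k j l + wedgeBasis j l i k - wedgeBasis j k i l - wedgeBasis i l j k) := by
  ext ⟨⟨a, b⟩, ⟨c, e⟩⟩
  simp only [exchangeOp_apply, wedgeBasis, wedgeVec_apply, PiLp.add_apply, PiLp.sub_apply,
    PiLp.smul_apply, smul_eq_mul]
  ring

lemma wedgeBasis_swap_left {d : ℕ} (i j k l : Fin d) :
    wedgeBasis j i k l = -wedgeBasis i j k l := by
  ext x
  simp only [wedgeBasis, wedgeVec_apply, PiLp.neg_apply]
  ring

lemma wedgeBasis_swap_right {d : ℕ} (i j k l : Fin d) :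
    wedgeBasis i j l k = -wedgeBasis i j k l := by
  ext x
  simp only [wedgeBasis, wedgeVec_apply, PiLp.neg_apply]
  ring

lemma wedgeBasis_self_left {d : ℕ} (i k l : Fin d) : wedgeBasis i i k l = 0 := by
  ext x
  simp only [wedgeBasis, wedgeVec_apply, PiLp.zero_apply]
  ring

lemma wedgeBasis_self_right {d : ℕ} (i j k : Fin d) : wedgeBasis i j k k = 0 := by
  ext x
  simp only [wedgeBasis, wedgeVec_apply, PiLp.zero_apply]
  ring

/-- The matrix that sends `e_b` to `e_{f b}`. -/
def relabelling {d : ℕ} (f : Fin d → Fin d) : Matrix (Fin d) (Fin d) ℂ :=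
  Matrix.of fun a b => stdVec (f b) a

lemma tensorFour_wedgeBasis {d : ℕ} (g : Matrix (Fin d) (Fin d) ℂ) (i j k l : Fin d) :
    tensorFour g (wedgeBasis i j k l) =
      wedgeVec (fun a => g a i) (fun a => g a j) (fun a => g a k) (fun a => g a l) := by
  rw [wedgeBasis, tensorFour_wedgeVec]
  simp only [mulVec_stdVec]

lemma tensorFour_relabelling {d : ℕ} (f : Fin d → Fin d) (i j k l : Fin d) :
    tensorFour (relabelling f) (wedgeBasis i j k l) = wedgeBasis (f i) (f j) (f k) (f l) := by
  rw [tensorFour_wedgeBasis]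
  rfl

/-- The commutant of `g ↦ g^{⊗4}` on `∧² ⊗ ∧²` is spanned by the three exchange operators. If
`d ≥ 4`, an operator `X` in it is determined by the image of `(e_0 ∧ e_1) ⊗ (e_2 ∧ e_3)`, because a
matrix can send `e_0, …, e_3` to any vectors; the weight leaves six coefficients in this image, and
antisymmetry of `(e_0 ∧ e_1) ⊗ (e_2 ∧ e_3)` in each pair identifies four of them up to sign. If
`d ≤ 3`, the two pairs of a basis vector share a letter, and the image of
`(e_0 ∧ e_1) ⊗ (e_0 ∧ e_2)` or of `(e_0 ∧ e_1) ⊗ (e_0 ∧ e_1)` suffices. -/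
theorem exists_eq_exchangeOp {d : ℕ} (hd : 2 ≤ d)
    (X : EuclideanSpace ℂ (Quad d) →ₗ[ℂ] EuclideanSpace ℂ (Quad d))
    (hX : ∀ M v, X (tensorFour M v) = tensorFour M (X v))
    (hmap : ∀ v ∈ wedgeTensorWedge d, X v ∈ wedgeTensorWedge d) :
    ∃ α β γ : ℂ, ∀ v ∈ wedgeTensorWedge d, X v = exchangeOp d α β γ v := by
  have hsupp : ∀ i j k l, SupportedOn (X (wedgeBasis i j k l)) ((i, j), (k, l)) := by
    intro i j k l x hx m
    refine letterCount_eq_of_doubling ?_ hx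
    rw [← hX, tensorFour_doubling_wedgeBasis, map_smul]
  have hanti : ∀ i j k l, IsBiAntisymm (X (wedgeBasis i j k l)) := fun i j k l =>
    mem_wedgeTensorWedge.mp (hmap _ (wedgeVec_mem _ _ _ _))
  suffices h : ∃ α β γ : ℂ, ∀ i j k l, X (wedgeBasis i j k l) =
      exchangeOp d α β γ (wedgeBasis i j k l) by
    obtain ⟨α, β, γ, h⟩ := h
    refine ⟨α, β, γ, fun v hv => ?_⟩
    rw [(mem_wedgeTensorWedge.mp hv).eq_sum]
    simp only [map_smul, map_sum, h]
  rcases (by omega : d = 2 ∨ d = 3 ∨ 4 ≤ d) with rfl | rfl | h4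
  · obtain ⟨c, hc⟩ : ∃ c : ℂ, X (wedgeBasis 0 1 0 1) = c • wedgeBasis 0 1 0 1 :=
      ⟨_, eq_of_supportedOn_two (hanti 0 1 0 1) zero_ne_one (hsupp 0 1 0 1)⟩
    refine ⟨c, 0, 0, fun i j k l => ?_⟩
    rw [exchangeOp_wedgeBasis, zero_smul, zero_smul, add_zero, add_zero]
    have hij : ∀ i j : Fin 2, X (wedgeBasis i j i j) = c • wedgeBasis i j i j := by
      intro i j
      have := congrArg (tensorFour (relabelling ![i, j])) hc
      rwa [← hX, map_smul, tensorFour_relabelling] at this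
    have hcases : i = j ∨ k = l ∨ (i = k ∧ j = l) ∨ (i = l ∧ j = k) := by omega
    rcases hcases with rfl | rfl | ⟨rfl, rfl⟩ | ⟨rfl, rfl⟩
    · rw [wedgeBasis_self_left, map_zero, smul_zero]
    · rw [wedgeBasis_self_right, map_zero, smul_zero]
    · exact hij i j
    · rw [wedgeBasis_swap_right, map_neg, hij, smul_neg]
  · obtain ⟨α, β, hαβ⟩ : ∃ α β : ℂ, X (wedgeBasis 0 1 0 2) =
        α • wedgeBasis 0 1 0 2 + β • wedgeBasis 0 2 0 1 := by
      have hu := eq_of_supportedOn_three (hanti 0 1 0 2) (by decide : (0 : Fin 3) ≠ 1)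
        (by decide : (0 : Fin 3) ≠ 2) (by decide : (1 : Fin 3) ≠ 2) (hsupp 0 1 0 2)
      exact ⟨_, _, hu⟩
    refine ⟨α, β, 0, fun i j k l => ?_⟩
    rw [exchangeOp_wedgeBasis, zero_smul, add_zero]
    have hijk : ∀ i j k : Fin 3, X (wedgeBasis i j i k) =
        α • wedgeBasis i j i k + β • wedgeBasis i k i j := by
      intro i j k
      have := congrArg (tensorFour (relabelling ![i, j, k])) hαβ
      rwa [← hX, map_add, map_smul, map_smul, tensorFour_relabelling, tensorFour_relabelling]
        at this
    have hcases : i = j ∨ k = l ∨ i = k ∨ i = l ∨ j = k ∨ j = l := by omega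
    rcases hcases with rfl | rfl | rfl | rfl | rfl | rfl
    · rw [wedgeBasis_self_left, wedgeBasis_self_right, map_zero, smul_zero, smul_zero, add_zero]
    · rw [wedgeBasis_self_left, wedgeBasis_self_right, map_zero, smul_zero, smul_zero, add_zero]
    · exact hijk i j l
    · rw [wedgeBasis_swap_right i j i k, wedgeBasis_swap_left i k i j, map_neg, hijk]
      module
    · rw [wedgeBasis_swap_left j i j l, wedgeBasis_swap_right j l j i, map_neg, hijk]
      module
    · rw [wedgeBasis_swap_left j i k j, wedgeBasis_swap_right j i j k,
        wedgeBasis_swap_left j k i j, wedgeBasis_swap_right j k j i, map_neg, map_neg, hijk]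
      module
  · obtain ⟨c₁, c₂, c₃, c₄, c₅, c₆, hc⟩ : ∃ c₁ c₂ c₃ c₄ c₅ c₆ : ℂ, ∀ i j k l,
        X (wedgeBasis i j k l) = c₁ • wedgeBasis i j k l + c₂ • wedgeBasis k l i j +
          c₃ • wedgeBasis i k j l + c₄ • wedgeBasis j l i k + c₅ • wedgeBasis i l j k +
          c₆ • wedgeBasis j k i l := by
      let n₀ : Fin d := ⟨0, by omega⟩
      let n₁ : Fin d := ⟨1, by omega⟩
      let n₂ : Fin d := ⟨2, by omega⟩
      let n₃ : Fin d := ⟨3, by omega⟩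
      have hn : n₀ ≠ n₁ ∧ n₀ ≠ n₂ ∧ n₀ ≠ n₃ ∧ n₁ ≠ n₂ ∧ n₁ ≠ n₃ ∧ n₂ ≠ n₃ := by
        simp [n₀, n₁, n₂, n₃]
      obtain ⟨h01, h02, h03, h12, h13, h23⟩ := hn
      have hu := eq_of_supportedOn_four (hanti n₀ n₁ n₂ n₃) h01 h02 h03 h12 h13 h23
        (hsupp n₀ n₁ n₂ n₃)
      generalize X (wedgeBasis n₀ n₁ n₂ n₃) ((n₀, n₁), n₂, n₃) = c₁,
        X (wedgeBasis n₀ n₁ n₂ n₃) ((n₂, n₃), n₀, n₁) = c₂,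
        X (wedgeBasis n₀ n₁ n₂ n₃) ((n₀, n₂), n₁, n₃) = c₃,
        X (wedgeBasis n₀ n₁ n₂ n₃) ((n₁, n₃), n₀, n₂) = c₄,
        X (wedgeBasis n₀ n₁ n₂ n₃) ((n₀, n₃), n₁, n₂) = c₅,
        X (wedgeBasis n₀ n₁ n₂ n₃) ((n₁, n₂), n₀, n₃) = c₆ at hu
      refine ⟨c₁, c₂, c₃, c₄, c₅, c₆, fun i j k l => ?_⟩
      let f : Fin d → Fin d := fun b => if b = n₀ then i else if b = n₁ then j else
        if b = n₂ then k else l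
      have f0 : f n₀ = i := by simp [f]
      have f1 : f n₁ = j := by simp [f, h01.symm]
      have f2 : f n₂ = k := by simp [f, h02.symm, h12.symm]
      have f3 : f n₃ = l := by simp [f, h03.symm, h13.symm, h23.symm]
      have := congrArg (tensorFour (relabelling f)) hu
      rw [← hX] at this
      simpa only [map_add, map_smul, tensorFour_relabelling, f0, f1, f2, f3] using this
    refine ⟨c₁, c₂, (c₃ + c₄ - c₅ - c₆) / 4, fun i j k l => ?_⟩
    -- averaging over the order inside the two pairs merges the last four coefficients
    have havg : X (wedgeBasis i j k l) = (1 / 4 : ℂ) • (X (wedgeBasis i j k l) -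
        X (wedgeBasis j i k l) - X (wedgeBasis i j l k) + X (wedgeBasis j i l k)) := by
      rw [wedgeBasis_swap_left i j l k, wedgeBasis_swap_left i j k l,
        wedgeBasis_swap_right i j k l]
      simp only [map_neg]
      module
    rw [havg, hc, hc, hc, hc, exchangeOp_wedgeBasis]
    ext x
    simp only [wedgeBasis, wedgeVec_apply, PiLp.add_apply, PiLp.sub_apply,
      PiLp.smul_apply, smul_eq_mul]
    ring

/-! ### The three isotypic subspaces -/

/-- The symmetry that singles out the component of shape `s` inside `∧² ⊗ ∧²`: for `1111`
antisymmetry in the two middle letters, hence in all four; for `22` the symmetries of a curvature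
tensor, pair exchange and the Bianchi identity; for `211` antisymmetry under exchange of the
pairs. -/
def HasShape {d : ℕ} : Shape → (Quad d → ℂ) → Prop
  | .s1111, v => ∀ a b c e, v ((a, c), (b, e)) = -v ((a, b), (c, e))
  | .s22, v => (∀ x y, v (y, x) = v (x, y)) ∧
      ∀ a b c e, v ((a, b), (c, e)) + v ((b, c), (a, e)) + v ((c, a), (b, e)) = 0
  | .s211, v => ∀ x y, v (y, x) = -v (x, y)

/-- The vectors of `∧² ⊗ ∧²` with the symmetry of the shape `s`. -/
def shapeSpace (d : ℕ) (s : Shape) : Submodule ℂ (EuclideanSpace ℂ (Quad d)) where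
  carrier := {v | v ∈ wedgeTensorWedge d ∧ HasShape s v}
  add_mem' := by
    rintro v w ⟨hv, hv'⟩ ⟨hw, hw'⟩
    refine ⟨Submodule.add_mem _ hv hw, ?_⟩
    cases s with
    | s1111 =>
      intro a b c e
      simp only [PiLp.add_apply]
      linear_combination hv' a b c e + hw' a b c e
    | s22 =>
      refine ⟨fun x y => ?_, fun a b c e => ?_⟩
      · simp only [PiLp.add_apply]
        linear_combination hv'.1 x y + hw'.1 x y
      · simp only [PiLp.add_apply]
        linear_combination hv'.2 a b c e + hw'.2 a b c e
    | s211 =>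
      intro x y
      simp only [PiLp.add_apply]
      linear_combination hv' x y + hw' x y
  zero_mem' := by
    refine ⟨Submodule.zero_mem _, ?_⟩
    cases s <;> simp [HasShape]
  smul_mem' := by
    rintro t v ⟨hv, hv'⟩
    refine ⟨Submodule.smul_mem _ _ hv, ?_⟩
    cases s with
    | s1111 =>
      intro a b c e
      simp only [PiLp.smul_apply, smul_eq_mul]
      linear_combination t * hv' a b c e
    | s22 =>
      refine ⟨fun x y => ?_, fun a b c e => ?_⟩
      · simp only [PiLp.smul_apply, smul_eq_mul]
        linear_combination t * hv'.1 x y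
      · simp only [PiLp.smul_apply, smul_eq_mul]
        linear_combination t * hv'.2 a b c e
    | s211 =>
      intro x y
      simp only [PiLp.smul_apply, smul_eq_mul]
      linear_combination t * hv' x y

lemma shapeSpace_le (d : ℕ) (s : Shape) : shapeSpace d s ≤ wedgeTensorWedge d := fun _ h => h.1

/-- `g^{⊗4}` commutes with permutations of the tensor factors. -/
lemma tensorFour_comp_perm {d : ℕ} (σ : Equiv.Perm (Quad d)) (g : Matrix (Fin d) (Fin d) ℂ)
    (hσ : ∀ x z, fourFold g (σ x) (σ z) = fourFold g x z) (v : EuclideanSpace ℂ (Quad d))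
    (x : Quad d) : tensorFour g v (σ x) = ∑ z, fourFold g x z * v (σ z) := by
  rw [tensorFour_apply, ← Equiv.sum_comp σ]
  exact Finset.sum_congr rfl fun z _ => congrArg (· * v (σ z)) (hσ x z)

lemma tensorFour_mem_wedgeTensorWedge {d : ℕ} (g : Matrix (Fin d) (Fin d) ℂ)
    {v : EuclideanSpace ℂ (Quad d)} (hv : v ∈ wedgeTensorWedge d) :
    tensorFour g v ∈ wedgeTensorWedge d := by
  rw [(mem_wedgeTensorWedge.mp hv).eq_sum]
  simp only [map_smul, map_sum, wedgeBasis, tensorFour_wedgeVec]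
  exact Submodule.smul_mem _ _ (Submodule.sum_mem _ fun x _ =>
    Submodule.smul_mem _ _ (wedgeVec_mem _ _ _ _))

/-- The exchange of the pairs `AB` and `A'B'`. -/
def pairSwap (d : ℕ) : Equiv.Perm (Quad d) := Equiv.prodComm _ _

/-- The exchange of `B` and `A'`. -/
def midSwap (d : ℕ) : Equiv.Perm (Quad d) where
  toFun x := ((x.1.1, x.2.1), (x.1.2, x.2.2))
  invFun x := ((x.1.1, x.2.1), (x.1.2, x.2.2))
  left_inv _ := rfl
  right_inv _ := rfl

/-- The cyclic permutation of `A`, `B`, `A'`. -/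
def cycle (d : ℕ) : Equiv.Perm (Quad d) where
  toFun x := ((x.1.2, x.2.1), (x.1.1, x.2.2))
  invFun x := ((x.2.1, x.1.1), (x.1.2, x.2.2))
  left_inv _ := rfl
  right_inv _ := rfl

lemma tensorFour_mem_shapeSpace {d : ℕ} {s : Shape} (g : Matrix (Fin d) (Fin d) ℂ)
    {v : EuclideanSpace ℂ (Quad d)} (hv : v ∈ shapeSpace d s) :
    tensorFour g v ∈ shapeSpace d s := by
  refine ⟨tensorFour_mem_wedgeTensorWedge g hv.1, ?_⟩
  have hp := tensorFour_comp_perm (pairSwap d) g (fun x z => by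
    simp only [fourFold, pairSwap, Equiv.prodComm_apply, Matrix.kroneckerMap_apply, Prod.swap]
    ring) v
  have hm := tensorFour_comp_perm (midSwap d) g (fun x z => by
    simp only [fourFold, midSwap, Equiv.coe_fn_mk, Matrix.kroneckerMap_apply]
    ring) v
  have hc := tensorFour_comp_perm (cycle d) g (fun x z => by
    simp only [fourFold, cycle, Equiv.coe_fn_mk, Matrix.kroneckerMap_apply]
    ring) v
  have hc' := tensorFour_comp_perm (cycle d * cycle d) g (fun x z => by
    simp only [fourFold, cycle, Equiv.Perm.mul_apply, Equiv.coe_fn_mk, Matrix.kroneckerMap_apply]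
    ring) v
  have h1 : ∀ x, tensorFour g v x = ∑ z, fourFold g x z * v z := tensorFour_apply g v
  cases s with
  | s1111 =>
    intro a b c e
    refine (hm ((a, b), (c, e))).trans ?_
    rw [h1, ← Finset.sum_neg_distrib]
    refine Finset.sum_congr rfl fun z _ => ?_
    rw [← mul_neg]
    exact congrArg _ (hv.2 z.1.1 z.1.2 z.2.1 z.2.2)
  | s22 =>
    refine ⟨fun x y => ?_, fun a b c e => ?_⟩
    · refine (hp (x, y)).trans ?_
      rw [h1]
      exact Finset.sum_congr rfl fun z _ => congrArg _ (hv.2.1 z.1 z.2)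
    · refine (congrArg₂ (· + ·) (congrArg₂ (· + ·) (h1 ((a, b), (c, e)))
        (hc ((a, b), (c, e)))) (hc' ((a, b), (c, e)))).trans ?_
      simp only [← Finset.sum_add_distrib, ← mul_add]
      refine Finset.sum_eq_zero fun z _ => ?_
      rw [mul_eq_zero]
      exact Or.inr (hv.2.2 z.1.1 z.1.2 z.2.1 z.2.2)
  | s211 =>
    intro x y
    refine (hp (x, y)).trans ?_
    rw [h1, ← Finset.sum_neg_distrib]
    refine Finset.sum_congr rfl fun z _ => ?_
    rw [← mul_neg]
    exact congrArg _ (hv.2 z.1 z.2)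

/-- The scalar by which `exchangeOp d α β γ` acts on the subspace of shape `s`. -/
def exchangeScalar (α β γ : ℂ) : Shape → ℂ
  | .s1111 => α + β - 4 * γ
  | .s22 => α + β + 2 * γ
  | .s211 => α - β

lemma exchangeOp_of_mem {d : ℕ} {s : Shape} {v : EuclideanSpace ℂ (Quad d)}
    (hv : v ∈ shapeSpace d s) (α β γ : ℂ) :
    exchangeOp d α β γ v = exchangeScalar α β γ s • v := by
  obtain ⟨h, hs⟩ := hv
  obtain ⟨h1, h2⟩ := mem_wedgeTensorWedge.mp h
  ext ⟨⟨a, b⟩, ⟨c, e⟩⟩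
  rw [exchangeOp_apply, PiLp.smul_apply, smul_eq_mul]
  cases s with
  | s1111 =>
    simp only [exchangeScalar]
    have e1 := hs a b c e
    have e2 := hs b a c e
    have e3 := hs a b e c
    have e4 := hs b a e c
    have e5 := hs c a e b
    have e6 := hs a c b e
    simp only [HasShape] at hs
    grind
  | s22 =>
    simp only [exchangeScalar]
    have e1 := hs.1 (a, b) (c, e)
    have e2 := hs.1 (a, c) (b, e)
    have e3 := hs.1 (b, c) (a, e)
    have e4 := hs.2 a b c e
    have e5 := h1 a c (b, e)
    linear_combination β * e1 + γ * e2 - γ * e3 - 2 * γ * e4 + 2 * γ * e5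
  | s211 =>
    simp only [exchangeScalar]
    have e1 := hs (a, b) (c, e)
    have e2 := hs (a, c) (b, e)
    have e3 := hs (b, c) (a, e)
    linear_combination β * e1 + γ * e2 - γ * e3

/-- The decomposition is obtained from exchange operators whose scalars are `1` on one of the three
subspaces and `0` on the others. -/
lemma exists_decomposition {d : ℕ} {v : EuclideanSpace ℂ (Quad d)} (hv : v ∈ wedgeTensorWedge d) :
    ∃ w : Shape → EuclideanSpace ℂ (Quad d), (∀ s, w s ∈ shapeSpace d s) ∧ v = ∑ s, w s := by
  obtain ⟨h1, h2⟩ := mem_wedgeTensorWedge.mp hv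
  let w : Shape → EuclideanSpace ℂ (Quad d)
    | .s1111 => exchangeOp d (1 / 6) (1 / 6) (-1 / 6) v
    | .s22 => exchangeOp d (1 / 3) (1 / 3) (1 / 6) v
    | .s211 => exchangeOp d (1 / 2) (-1 / 2) 0 v
  refine ⟨w, fun s => ⟨?_, ?_⟩, ?_⟩
  · have hanti : ∀ α β γ, exchangeOp d α β γ v ∈ wedgeTensorWedge d := by
      intro α β γ
      rw [(mem_wedgeTensorWedge.mp hv).eq_sum]
      simp only [map_smul, map_sum, exchangeOp_wedgeBasis]
      refine Submodule.smul_mem _ _ (Submodule.sum_mem _ fun x _ => Submodule.smul_mem _ _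
        (Submodule.add_mem _ (Submodule.add_mem _ (Submodule.smul_mem _ _ (wedgeVec_mem _ _ _ _))
        (Submodule.smul_mem _ _ (wedgeVec_mem _ _ _ _))) (Submodule.smul_mem _ _
        (Submodule.sub_mem _ (Submodule.sub_mem _ (Submodule.add_mem _ ?_ ?_) ?_) ?_)))) <;>
      exact wedgeVec_mem _ _ _ _
    cases s <;> exact hanti _ _ _
  · cases s with
    | s1111 =>
      intro a b c e
      simp only [w, exchangeOp_apply]
      linear_combination (1 / 6 : ℂ) * (h1 b c (a, e) + h2 (a, e) b c)
    | s22 =>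
      refine ⟨?_, ?_⟩
      · rintro ⟨a, b⟩ ⟨c, e⟩
        simp only [w, exchangeOp_apply]
        grind
      · intro a b c e
        simp only [w, exchangeOp_apply]
        grind
    | s211 =>
      rintro ⟨a, b⟩ ⟨c, e⟩
      simp only [w, exchangeOp_apply]
      ring
  · have : (Finset.univ : Finset Shape) = {.s1111, .s22, .s211} := rfl
    rw [this]
    ext ⟨⟨a, b⟩, ⟨c, e⟩⟩
    simp [w, exchangeOp_apply]
    ring

/-! ### Identification of the components -/

lemma fourFold_conjTranspose {d : ℕ} (g : Matrix (Fin d) (Fin d) ℂ) :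
    (fourFold g).conjTranspose = fourFold g.conjTranspose := by
  simp only [fourFold, Matrix.conjTranspose_kronecker]

lemma inner_tensorFour {d : ℕ} (g : Matrix (Fin d) (Fin d) ℂ)
    (v w : EuclideanSpace ℂ (Quad d)) :
    inner ℂ (tensorFour g v) w = inner ℂ v (tensorFour g.conjTranspose w) := by
  have h : tensorFour g.conjTranspose = LinearMap.adjoint (tensorFour g) := by
    rw [tensorFour, tensorFour, ← Matrix.toEuclideanLin_conjTranspose_eq_adjoint]
    exact congrArg _ (fourFold_conjTranspose g).symm
  rw [h, LinearMap.adjoint_inner_right]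

lemma starProjection_tensorFour {d : ℕ} {W : Submodule ℂ (EuclideanSpace ℂ (Quad d))}
    (hW : IsInvariant W) {g : Matrix (Fin d) (Fin d) ℂ} (hg : g ∈ Matrix.unitaryGroup (Fin d) ℂ)
    (v : EuclideanSpace ℂ (Quad d)) :
    W.starProjection (tensorFour g v) = tensorFour g (W.starProjection v) := by
  refine Submodule.eq_starProjection_of_mem_of_inner_eq_zero
    (hW g hg _ (W.starProjection_apply_mem v)) fun w hw => ?_
  rw [← map_sub, inner_tensorFour]
  exact W.starProjection_inner_eq_zero v _ (hW _ (Unitary.star_mem hg) w hw)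

/-- An operator that commutes with the representation and preserves `∧² ⊗ ∧²` is a scalar on each
of the three subspaces. -/
lemma exists_scalar {d : ℕ} (hd : 2 ≤ d) {X : Matrix (Quad d) (Quad d) ℂ}
    (hX : ∀ g ∈ Matrix.unitaryGroup (Fin d) ℂ, X * fourFold g = fourFold g * X)
    (hmap : ∀ v ∈ wedgeTensorWedge d, Matrix.toEuclideanLin X v ∈ wedgeTensorWedge d) :
    ∃ α β γ : ℂ, ∀ s, ∀ v ∈ shapeSpace d s,
      Matrix.toEuclideanLin X v = exchangeScalar α β γ s • v := by
  have hcomm : ∀ M v, Matrix.toEuclideanLin X (tensorFour M v) =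
      tensorFour M (Matrix.toEuclideanLin X v) := by
    intro M v
    have := congrArg (fun Y => Matrix.toEuclideanLin Y v) (commute_fourFold hX M)
    rwa [Matrix.toLpLin_mul_same, Matrix.toLpLin_mul_same] at this
  obtain ⟨α, β, γ, h⟩ := exists_eq_exchangeOp hd _ hcomm hmap
  exact ⟨α, β, γ, fun s v hv => (h v hv.1).trans (exchangeOp_of_mem hv α β γ)⟩

lemma exists_scalar_starProjection {d : ℕ} (hd : 2 ≤ d)
    {W : Submodule ℂ (EuclideanSpace ℂ (Quad d))} (hW : IsInvariant W)
    (hle : W ≤ wedgeTensorWedge d) :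
    ∃ c : Shape → ℂ, ∀ s, ∀ v ∈ shapeSpace d s, W.starProjection v = c s • v := by
  let X : Matrix (Quad d) (Quad d) ℂ := Matrix.toEuclideanLin.symm W.starProjection.toLinearMap
  have hX : Matrix.toEuclideanLin X = W.starProjection.toLinearMap :=
    LinearEquiv.apply_symm_apply _ _
  obtain ⟨α, β, γ, h⟩ := exists_scalar hd (X := X) (fun g hg => by
      apply Matrix.toEuclideanLin.injective
      rw [Matrix.toLpLin_mul_same, Matrix.toLpLin_mul_same, hX]
      exact LinearMap.ext fun v => starProjection_tensorFour hW hg v) (fun v _ => by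
      rw [hX]
      exact hle (W.starProjection_apply_mem v))
  refine ⟨exchangeScalar α β γ, fun s v hv => ?_⟩
  rw [← h s v hv, hX]
  rfl

lemma isInvariant_shapeSpace (d : ℕ) (s : Shape) : IsInvariant (shapeSpace d s) :=
  fun g _ _ hv => tensorFour_mem_shapeSpace g hv

lemma isIrreducibleSubrep_shapeSpace {d : ℕ} (hd : 2 ≤ d) {s : Shape} (hs : shapeSpace d s ≠ ⊥) :
    IsIrreducibleSubrep (shapeSpace d s) := by
  refine ⟨isInvariant_shapeSpace d s, hs, fun W hW hle => ?_⟩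
  obtain ⟨c, hc⟩ := exists_scalar_starProjection hd hW (hle.trans (shapeSpace_le d s))
  rw [or_iff_not_imp_left]
  intro hne
  obtain ⟨w, hw, hw0⟩ := (Submodule.ne_bot_iff W).mp hne
  have h1 : c s = 1 := by
    have h := hc s w (hle hw)
    rw [W.starProjection_eq_self_iff.mpr hw] at h
    have h' : (1 - c s) • w = 0 := by rw [sub_smul, one_smul, ← h, sub_self]
    exact (sub_eq_zero.mp ((smul_eq_zero.mp h').resolve_right hw0)).symm
  refine le_antisymm hle fun v hv => ?_
  rw [← W.starProjection_eq_self_iff, hc s v hv, h1, one_smul]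

/-- The exchange operator with coefficients `0, 1, 2` has the distinct scalars `-7`, `5`, `-1` on
the three subspaces. -/
lemma disjoint_shapeSpace {d : ℕ} {s t : Shape} (hst : s ≠ t) {v : EuclideanSpace ℂ (Quad d)}
    (hs : v ∈ shapeSpace d s) (ht : v ∈ shapeSpace d t) : v = 0 := by
  have h := (exchangeOp_of_mem hs 0 1 2).symm.trans (exchangeOp_of_mem ht 0 1 2)
  rw [← sub_eq_zero, ← sub_smul] at h
  refine (smul_eq_zero.mp h).resolve_left ?_
  cases s <;> cases t <;> first | exact absurd rfl hst | norm_num [exchangeScalar]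

lemma starProjection_shapeSpace_of_ne {d : ℕ} (hd : 2 ≤ d) {s t : Shape} (hst : s ≠ t)
    {v : EuclideanSpace ℂ (Quad d)} (hv : v ∈ shapeSpace d t) :
    (shapeSpace d s).starProjection v = 0 := by
  obtain ⟨c, hc⟩ := exists_scalar_starProjection hd (isInvariant_shapeSpace d s)
    (shapeSpace_le d s)
  refine disjoint_shapeSpace hst ((shapeSpace d s).starProjection_apply_mem v) ?_
  rw [hc t v hv]
  exact Submodule.smul_mem _ _ hv

/-! ### Highest weight vectors -/

lemma sum_letterCount {d : ℕ} (x : Quad d) : ∑ m, letterCount m x = 4 := by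
  simp [letterCount, Finset.sum_add_distrib]

lemma IsHighestWeightVector.letterCount_eq {d : ℕ} {s : Shape} {v : EuclideanSpace ℂ (Quad d)}
    (hv : IsHighestWeightVector s v) {x : Quad d} (hx : v x ≠ 0) (m : Fin d) :
    letterCount m x = s.row m := by
  refine letterCount_eq_of_doubling (m := m) ?_ hx
  rw [hv.2 (doubling m)]
  · congr 1
    rw [Finset.prod_eq_single m]
    · simp [doubling]
    · intro j _ hj
      simp [doubling, hj]
    · simp
  · rw [Matrix.isUnit_iff_isUnit_det, doubling, Matrix.det_diagonal, isUnit_iff_ne_zero]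
    refine Finset.prod_ne_zero_iff.mpr fun j _ => ?_
    split_ifs <;> norm_num
  · intro i j hij
    exact Matrix.diagonal_apply_ne _ hij.ne'

lemma IsHighestWeightVector.sum_row {d : ℕ} {s : Shape} {v : EuclideanSpace ℂ (Quad d)}
    (hv : IsHighestWeightVector s v) : ∑ m : Fin d, s.row m = 4 := by
  obtain ⟨x, hx⟩ : ∃ x, v x ≠ 0 := by
    by_contra! h
    exact hv.1 (PiLp.ext h)
  rw [← sum_letterCount x]
  exact Finset.sum_congr rfl fun m _ => (hv.letterCount_eq hx m).symm

lemma IsHighestWeightVector.transvection {d : ℕ} {s : Shape} {v : EuclideanSpace ℂ (Quad d)}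
    (hv : IsHighestWeightVector s v) {i j : Fin d} (hij : i < j) :
    tensorFour (Matrix.transvection i j 1) v = v := by
  rw [hv.2]
  · rw [Finset.prod_eq_one, one_smul]
    intro k _
    have : Matrix.transvection i j (1 : ℂ) k k = 1 := by
      simp [Matrix.transvection, Matrix.single_apply]
      rintro rfl rfl
      exact hij.ne rfl
    rw [this, one_pow]
  · rw [Matrix.isUnit_iff_isUnit_det, Matrix.det_transvection_of_ne _ _ hij.ne]
    exact isUnit_one
  · intro k l hkl
    have : ¬(i = k ∧ j = l) := by
      rintro ⟨rfl, rfl⟩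
      exact lt_asymm hij hkl
    simp [Matrix.transvection, hkl.ne', this]

/-- A highest weight vector of weight `s` in `∧² ⊗ ∧²` has the symmetry of the shape `s`: its
weight confines it to the span of one, two or six basis vectors, and invariance under simple
transvections fixes the ratios of the coefficients. -/
lemma IsHighestWeightVector.mem_shapeSpace {d : ℕ} (hd : 2 ≤ d) {s : Shape}
    {v : EuclideanSpace ℂ (Quad d)} (hv : IsHighestWeightVector s v)
    (hvW : v ∈ wedgeTensorWedge d) : v ∈ shapeSpace d s := by
  have hanti := mem_wedgeTensorWedge.mp hvW
  cases s with
  | s22 =>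
    let n₀ : Fin d := ⟨0, by omega⟩
    let n₁ : Fin d := ⟨1, by omega⟩
    have h01 : n₀ ≠ n₁ := by simp [n₀, n₁]
    have hs : SupportedOn v ((n₀, n₁), (n₀, n₁)) := by
      intro x hx m
      rw [hv.letterCount_eq hx m]
      obtain ⟨_ | _ | m, hm⟩ := m <;> simp [letterCount, Shape.row, n₀, n₁]
    rw [eq_of_supportedOn_two hanti h01 hs]
    refine Submodule.smul_mem _ _ ⟨wedgeVec_mem _ _ _ _, fun x y => ?_, fun a b c e => ?_⟩
    · simp only [wedgeBasis, wedgeVec_apply]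
      ring
    · simp only [wedgeBasis, wedgeVec_apply]
      ring
  | s211 =>
    obtain hd3 | hd3 : d = 2 ∨ 3 ≤ d := by omega
    · subst hd3
      have := hv.sum_row
      simp [Fin.sum_univ_two, Shape.row] at this
    let n₀ : Fin d := ⟨0, by omega⟩
    let n₁ : Fin d := ⟨1, by omega⟩
    let n₂ : Fin d := ⟨2, by omega⟩
    have h01 : n₀ ≠ n₁ := by simp [n₀, n₁]
    have h02 : n₀ ≠ n₂ := by simp [n₀, n₂]
    have h12 : n₁ ≠ n₂ := by simp [n₁, n₂]
    have hs : SupportedOn v ((n₀, n₁), (n₀, n₂)) := by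
      intro x hx m
      rw [hv.letterCount_eq hx m]
      obtain ⟨_ | _ | _ | m, hm⟩ := m <;> simp [letterCount, Shape.row, n₀, n₁, n₂]
    have hv' := eq_of_supportedOn_three hanti h01 h02 h12 hs
    have ht := hv.transvection (i := n₁) (j := n₂) (by simp [n₁, n₂])
    generalize v ((n₀, n₁), (n₀, n₂)) = α, v ((n₀, n₂), (n₀, n₁)) = β at hv'
    rw [hv'] at ht ⊢
    have hαβ := congrArg (fun w : EuclideanSpace ℂ (Quad d) => w ((n₀, n₁), (n₀, n₁))) ht
    simp only [map_add, map_smul, tensorFour_wedgeBasis] at hαβ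
    simp [wedgeBasis, stdVec, Matrix.transvection, Matrix.single_apply, Matrix.one_apply,
      h01, h01.symm, h02, h02.symm, h12, h12.symm] at hαβ
    obtain rfl : β = -α := by linear_combination hαβ
    refine ⟨Submodule.add_mem _ (Submodule.smul_mem _ _ (wedgeVec_mem _ _ _ _))
      (Submodule.smul_mem _ _ (wedgeVec_mem _ _ _ _)), fun x y => ?_⟩
    simp only [wedgeBasis, wedgeVec_apply, PiLp.add_apply, PiLp.smul_apply, smul_eq_mul]
    ring
  | s1111 =>
    obtain hd3 | hd3 | hd4 : d = 2 ∨ d = 3 ∨ 4 ≤ d := by omega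
    · subst hd3
      have := hv.sum_row
      simp [Fin.sum_univ_two, Shape.row] at this
    · subst hd3
      have := hv.sum_row
      simp [Fin.sum_univ_three, Shape.row] at this
    let n₀ : Fin d := ⟨0, by omega⟩
    let n₁ : Fin d := ⟨1, by omega⟩
    let n₂ : Fin d := ⟨2, by omega⟩
    let n₃ : Fin d := ⟨3, by omega⟩
    have hn : n₀ ≠ n₁ ∧ n₀ ≠ n₂ ∧ n₀ ≠ n₃ ∧ n₁ ≠ n₂ ∧ n₁ ≠ n₃ ∧ n₂ ≠ n₃ := by
      simp [n₀, n₁, n₂, n₃]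
    obtain ⟨h01, h02, h03, h12, h13, h23⟩ := hn
    have hs : SupportedOn v ((n₀, n₁), (n₂, n₃)) := by
      intro x hx m
      rw [hv.letterCount_eq hx m]
      obtain ⟨_ | _ | _ | _ | m, hm⟩ := m <;> simp [letterCount, Shape.row, n₀, n₁, n₂, n₃]
    have hv' := eq_of_supportedOn_four hanti h01 h02 h03 h12 h13 h23 hs
    have ht01 := hv.transvection (i := n₀) (j := n₁) (by simp [n₀, n₁])
    have ht12 := hv.transvection (i := n₁) (j := n₂) (by simp [n₁, n₂])
    have ht23 := hv.transvection (i := n₂) (j := n₃) (by simp [n₂, n₃])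
    generalize v ((n₀, n₁), (n₂, n₃)) = c₁, v ((n₂, n₃), (n₀, n₁)) = c₂,
      v ((n₀, n₂), (n₁, n₃)) = c₃, v ((n₁, n₃), (n₀, n₂)) = c₄,
      v ((n₀, n₃), (n₁, n₂)) = c₅, v ((n₁, n₂), (n₀, n₃)) = c₆ at hv'
    clear_value n₀ n₁ n₂ n₃
    rw [hv'] at ht01 ht12 ht23 ⊢
    have e1 := congrArg (fun w : EuclideanSpace ℂ (Quad d) => w ((n₀, n₂), (n₁, n₂))) ht23
    have e2 := congrArg (fun w : EuclideanSpace ℂ (Quad d) => w ((n₁, n₂), (n₀, n₂))) ht23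
    have e3 := congrArg (fun w : EuclideanSpace ℂ (Quad d) => w ((n₀, n₁), (n₁, n₃))) ht12
    have e4 := congrArg (fun w : EuclideanSpace ℂ (Quad d) => w ((n₁, n₃), (n₀, n₁))) ht12
    have e5 := congrArg (fun w : EuclideanSpace ℂ (Quad d) => w ((n₀, n₂), (n₀, n₃))) ht01
    clear ht01 ht12 ht23
    simp only [map_add, map_smul, tensorFour_wedgeBasis] at e1 e2 e3 e4 e5
    simp [wedgeBasis, stdVec, Matrix.transvection, Matrix.single_apply, Matrix.one_apply,
      h01, h01.symm, h02, h02.symm, h12, h12.symm, h03, h03.symm, h13, h13.symm,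
      h23, h23.symm] at e1 e2 e3 e4 e5
    obtain rfl : c₅ = -c₃ := by linear_combination e1
    obtain rfl : c₆ = -c₄ := by linear_combination e2
    obtain rfl : c₃ = -c₁ := by linear_combination e3
    obtain rfl : c₄ = -c₂ := by linear_combination e4
    obtain rfl : c₂ = c₁ := by linear_combination e5
    refine ⟨?_, fun a b c e => ?_⟩
    · refine Submodule.add_mem _ (Submodule.add_mem _ (Submodule.add_mem _
        (Submodule.add_mem _ (Submodule.add_mem _ ?_ ?_) ?_) ?_) ?_) ?_ <;>
      exact Submodule.smul_mem _ _ (wedgeVec_mem _ _ _ _)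
    · simp only [wedgeBasis, wedgeVec_apply, PiLp.add_apply, PiLp.smul_apply, smul_eq_mul]
      ring

lemma shapeSpace_eq_bot_of_lt {d : ℕ} {s : Shape} (h : (s = .s1111 ∧ d ≤ 3) ∨ (s = .s211 ∧ d ≤ 2)) :
    shapeSpace d s = ⊥ := by
  rw [Submodule.eq_bot_iff]
  rintro v ⟨hvW, hs⟩
  obtain ⟨h1, h2⟩ := mem_wedgeTensorWedge.mp hvW
  ext ⟨⟨a, b⟩, ⟨c, e⟩⟩
  rw [PiLp.zero_apply]
  rcases h with ⟨rfl, hd⟩ | ⟨rfl, hd⟩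
  · have hcases : a = b ∨ c = e ∨ a = c ∨ a = e ∨ b = c ∨ b = e := by omega
    simp only [HasShape] at hs
    grind
  · have hcases : a = b ∨ c = e ∨ (a = c ∧ b = e) ∨ (a = e ∧ b = c) := by omega
    simp only [HasShape] at hs
    grind

lemma upperTriangular_col {d : ℕ} {b : Matrix (Fin d) (Fin d) ℂ}
    (hb : ∀ i j, j < i → b i j = 0) (j : Fin d) :
    (fun a => b a j) = fun a => ∑ k ∈ Finset.Iic j, b k j * stdVec k a := by
  ext a
  simp only [stdVec, mul_ite, mul_one, mul_zero, Finset.sum_ite_eq, Finset.mem_Iic]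
  split_ifs with h
  · rfl
  · exact hb a j (not_le.mp h)

lemma prod_diag_pow_row {d : ℕ} (b : Matrix (Fin d) (Fin d) ℂ) {s : Shape} (j : Fin d)
    (hj : ∀ i, j < i → s.row i = 0) :
    ∏ i : Fin d, b i i ^ s.row i = ∏ i ∈ Finset.Iic j, b i i ^ s.row i := by
  refine (Finset.prod_subset (Finset.subset_univ _) fun i _ hi => ?_).symm
  rw [hj i (by simpa using hi), pow_zero]

/-- A nonzero subspace of symmetry `s` contains a highest weight vector of weight `s`. -/
lemma exists_highestWeightVector {d : ℕ} (hd : 2 ≤ d) {s : Shape} (hs : shapeSpace d s ≠ ⊥) :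
    ∃ v ∈ shapeSpace d s, IsHighestWeightVector s v := by
  cases s with
  | s22 =>
    let n₀ : Fin d := ⟨0, by omega⟩
    let n₁ : Fin d := ⟨1, by omega⟩
    have h01 : n₀ ≠ n₁ := by simp [n₀, n₁]
    have i0 : Finset.Iic n₀ = {n₀} := by ext a; simp [n₀, Fin.le_def, Fin.ext_iff]
    have i1 : Finset.Iic n₁ = {n₀, n₁} := by
      ext a; simp [n₀, n₁, Fin.le_def, Fin.ext_iff]; omega
    have r0 : Shape.row .s22 n₀ = 2 := rfl
    have r1 : Shape.row .s22 n₁ = 2 := rfl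
    have hr : ∀ i, n₁ < i → Shape.row .s22 i = 0 := by
      rintro ⟨_ | _ | i, hi⟩ h <;> simp [n₁, Fin.lt_def, Shape.row] at h ⊢
    clear_value n₀ n₁
    refine ⟨wedgeBasis n₀ n₁ n₀ n₁, ⟨wedgeVec_mem _ _ _ _, fun x y => ?_, fun a b c e => ?_⟩,
      fun h => ?_, fun b _ hb => ?_⟩
    · simp only [wedgeBasis, wedgeVec_apply]
      ring
    · simp only [wedgeBasis, wedgeVec_apply]
      ring
    · have := congrArg (fun w : EuclideanSpace ℂ (Quad d) => w ((n₀, n₁), (n₀, n₁))) h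
      simp [wedgeBasis, stdVec, h01, h01.symm] at this
    · rw [tensorFour_wedgeBasis, prod_diag_pow_row b n₁ hr, upperTriangular_col hb n₀,
        upperTriangular_col hb n₁, i0, i1, Finset.prod_pair h01, r0, r1]
      simp only [Finset.sum_pair h01, Finset.sum_singleton]
      ext x
      simp only [wedgeBasis, wedgeVec_apply, PiLp.smul_apply, smul_eq_mul]
      ring
  | s211 =>
    have hd3 : 3 ≤ d := by
      by_contra h
      exact hs (shapeSpace_eq_bot_of_lt (.inr ⟨rfl, by omega⟩))
    let n₀ : Fin d := ⟨0, by omega⟩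
    let n₁ : Fin d := ⟨1, by omega⟩
    let n₂ : Fin d := ⟨2, by omega⟩
    have h01 : n₀ ≠ n₁ := by simp [n₀, n₁]
    have h02 : n₀ ≠ n₂ := by simp [n₀, n₂]
    have h12 : n₁ ≠ n₂ := by simp [n₁, n₂]
    have i0 : Finset.Iic n₀ = {n₀} := by ext a; simp [n₀, Fin.le_def, Fin.ext_iff]
    have i1 : Finset.Iic n₁ = {n₀, n₁} := by
      ext a; simp [n₀, n₁, Fin.le_def, Fin.ext_iff]; omega
    have i2 : Finset.Iic n₂ = {n₀, n₁, n₂} := by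
      ext a; simp [n₀, n₁, n₂, Fin.le_def, Fin.ext_iff]; omega
    have r0 : Shape.row .s211 n₀ = 2 := rfl
    have r1 : Shape.row .s211 n₁ = 1 := rfl
    have r2 : Shape.row .s211 n₂ = 1 := rfl
    have hr : ∀ i, n₂ < i → Shape.row .s211 i = 0 := by
      rintro ⟨_ | _ | _ | i, hi⟩ h <;> simp [n₂, Fin.lt_def, Shape.row] at h ⊢
    clear_value n₀ n₁ n₂
    refine ⟨wedgeBasis n₀ n₁ n₀ n₂ - wedgeBasis n₀ n₂ n₀ n₁,
      ⟨Submodule.sub_mem _ (wedgeVec_mem _ _ _ _) (wedgeVec_mem _ _ _ _), fun x y => ?_⟩,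
      fun h => ?_, fun b _ hb => ?_⟩
    · simp only [wedgeBasis, wedgeVec_apply, PiLp.sub_apply]
      ring
    · have := congrArg (fun w : EuclideanSpace ℂ (Quad d) => w ((n₀, n₁), (n₀, n₂))) h
      simp [wedgeBasis, stdVec, h01, h01.symm, h02, h02.symm, h12, h12.symm] at this
    · rw [map_sub, tensorFour_wedgeBasis, tensorFour_wedgeBasis, prod_diag_pow_row b n₂ hr,
        upperTriangular_col hb n₀, upperTriangular_col hb n₁, upperTriangular_col hb n₂, i0, i1,
        i2, Finset.prod_insert (by simp [h01, h02]), Finset.prod_pair h12, r0, r1, r2]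
      simp only [Finset.sum_insert (show n₀ ∉ ({n₁, n₂} : Finset (Fin d)) by simp [h01, h02]),
        Finset.sum_pair h01, Finset.sum_pair h12, Finset.sum_singleton]
      ext x
      simp only [wedgeBasis, wedgeVec_apply, PiLp.smul_apply, PiLp.sub_apply, smul_eq_mul]
      ring
  | s1111 =>
    have hd4 : 4 ≤ d := by
      by_contra h
      exact hs (shapeSpace_eq_bot_of_lt (.inl ⟨rfl, by omega⟩))
    let n₀ : Fin d := ⟨0, by omega⟩
    let n₁ : Fin d := ⟨1, by omega⟩
    let n₂ : Fin d := ⟨2, by omega⟩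
    let n₃ : Fin d := ⟨3, by omega⟩
    have hn : n₀ ≠ n₁ ∧ n₀ ≠ n₂ ∧ n₀ ≠ n₃ ∧ n₁ ≠ n₂ ∧ n₁ ≠ n₃ ∧ n₂ ≠ n₃ := by
      simp [n₀, n₁, n₂, n₃]
    obtain ⟨h01, h02, h03, h12, h13, h23⟩ := hn
    have i0 : Finset.Iic n₀ = {n₀} := by ext a; simp [n₀, Fin.le_def, Fin.ext_iff]
    have i1 : Finset.Iic n₁ = {n₀, n₁} := by
      ext a; simp [n₀, n₁, Fin.le_def, Fin.ext_iff]; omega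
    have i2 : Finset.Iic n₂ = {n₀, n₁, n₂} := by
      ext a; simp [n₀, n₁, n₂, Fin.le_def, Fin.ext_iff]; omega
    have i3 : Finset.Iic n₃ = {n₀, n₁, n₂, n₃} := by
      ext a; simp [n₀, n₁, n₂, n₃, Fin.le_def, Fin.ext_iff]; omega
    have r0 : Shape.row .s1111 n₀ = 1 := rfl
    have r1 : Shape.row .s1111 n₁ = 1 := rfl
    have r2 : Shape.row .s1111 n₂ = 1 := rfl
    have r3 : Shape.row .s1111 n₃ = 1 := rfl
    have hr : ∀ i, n₃ < i → Shape.row .s1111 i = 0 := by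
      rintro ⟨_ | _ | _ | _ | i, hi⟩ h <;> simp [n₃, Fin.lt_def, Shape.row] at h ⊢
    clear_value n₀ n₁ n₂ n₃
    -- the antisymmetrisation of `e_0 ⊗ e_1 ⊗ e_2 ⊗ e_3`, grouped by the letters of the first pair
    refine ⟨wedgeBasis n₀ n₁ n₂ n₃ + wedgeBasis n₂ n₃ n₀ n₁ - wedgeBasis n₀ n₂ n₁ n₃ -
        wedgeBasis n₁ n₃ n₀ n₂ + wedgeBasis n₀ n₃ n₁ n₂ + wedgeBasis n₁ n₂ n₀ n₃,
      ⟨?_, fun a b c e => ?_⟩, fun h => ?_, fun b _ hb => ?_⟩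
    · refine Submodule.add_mem _ (Submodule.add_mem _ (Submodule.sub_mem _
        (Submodule.sub_mem _ (Submodule.add_mem _ ?_ ?_) ?_) ?_) ?_) ?_ <;>
      exact wedgeVec_mem _ _ _ _
    · simp only [wedgeBasis, wedgeVec_apply, PiLp.sub_apply, PiLp.add_apply]
      ring
    · have := congrArg (fun w : EuclideanSpace ℂ (Quad d) => w ((n₀, n₁), (n₂, n₃))) h
      simp [wedgeBasis, stdVec, h01, h01.symm, h02, h02.symm, h12, h12.symm, h03, h03.symm,
        h13, h13.symm, h23, h23.symm] at this
    · simp only [map_add, map_sub, tensorFour_wedgeBasis]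
      rw [prod_diag_pow_row b n₃ hr,
        upperTriangular_col hb n₀, upperTriangular_col hb n₁, upperTriangular_col hb n₂,
        upperTriangular_col hb n₃, i0, i1, i2, i3,
        Finset.prod_insert (by simp [h01, h02, h03]), Finset.prod_insert (by simp [h12, h13]),
        Finset.prod_pair h23, r0, r1, r2, r3]
      simp only [
        Finset.sum_insert (show n₀ ∉ ({n₁, n₂, n₃} : Finset (Fin d)) by simp [h01, h02, h03]),
        Finset.sum_insert (show n₀ ∉ ({n₁, n₂} : Finset (Fin d)) by simp [h01, h02]),
        Finset.sum_insert (show n₁ ∉ ({n₂, n₃} : Finset (Fin d)) by simp [h12, h13]),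
        Finset.sum_pair h01, Finset.sum_pair h12, Finset.sum_pair h23, Finset.sum_singleton]
      ext x
      simp only [wedgeBasis, wedgeVec_apply, PiLp.smul_apply, PiLp.sub_apply, PiLp.add_apply,
        smul_eq_mul, pow_one]
      ring

/-- The components of the representation on `∧² ⊗ ∧²` are the three subspaces of given symmetry. -/
theorem component_eq_shapeSpace {d : ℕ} (hd : 2 ≤ d) (s : Shape) :
    component d s = shapeSpace d s := by
  apply le_antisymm
  · refine sSup_le ?_
    rintro W ⟨hle, ⟨hinv, -, hirr⟩, v, hvW, hv⟩
    have hmem := hv.mem_shapeSpace hd (hle hvW)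
    rcases hirr (W ⊓ shapeSpace d s) (fun g hg w hw =>
      ⟨hinv g hg w hw.1, tensorFour_mem_shapeSpace g hw.2⟩) inf_le_left with h | h
    · exact absurd ((Submodule.eq_bot_iff _).mp h v ⟨hvW, hmem⟩) hv.1
    · exact inf_eq_left.mp h
  · by_cases hs : shapeSpace d s = ⊥
    · rw [hs]
      exact bot_le
    · exact le_sSup ⟨shapeSpace_le d s, isIrreducibleSubrep_shapeSpace hd hs,
        exists_highestWeightVector hd hs⟩

/-! ### The commutant as the span of the component projectors -/

lemma toEuclideanLin_componentProj {d : ℕ} (hd : 2 ≤ d) (s : Shape) :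
    Matrix.toEuclideanLin (componentProj d s) = (shapeSpace d s).starProjection.toLinearMap := by
  rw [componentProj, LinearEquiv.apply_symm_apply]
  simp only [component_eq_shapeSpace hd]

lemma componentProj_mul_self {d : ℕ} (hd : 2 ≤ d) (s : Shape) :
    componentProj d s * componentProj d s = componentProj d s := by
  apply Matrix.toEuclideanLin.injective
  rw [Matrix.toLpLin_mul_same, toEuclideanLin_componentProj hd]
  exact LinearMap.ext fun v =>
    Submodule.starProjection_eq_self_iff.mpr (Submodule.starProjection_apply_mem _ v)

lemma componentProj_mul_of_ne {d : ℕ} (hd : 2 ≤ d) {s t : Shape} (hst : s ≠ t) :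
    componentProj d s * componentProj d t = 0 := by
  apply Matrix.toEuclideanLin.injective
  rw [Matrix.toLpLin_mul_same, toEuclideanLin_componentProj hd, toEuclideanLin_componentProj hd,
    map_zero]
  exact LinearMap.ext fun v =>
    starProjection_shapeSpace_of_ne hd hst (Submodule.starProjection_apply_mem _ v)

lemma componentProj_isHermitian (d : ℕ) (s : Shape) : (componentProj d s).IsHermitian := by
  rw [← Matrix.isSymmetric_toEuclideanLin_iff, componentProj, LinearEquiv.apply_symm_apply]
  exact (component d s).starProjection_isSymmetric

lemma componentProj_eq_zero {d : ℕ} (hd : 2 ≤ d) {s : Shape}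
    (h : (componentProj d s).trace = 0) : componentProj d s = 0 := by
  rw [← Matrix.trace_conjTranspose_mul_self_eq_zero_iff, (componentProj_isHermitian d s).eq,
    componentProj_mul_self hd, h]

lemma trace_rho {d : ℕ} (hd : 2 ≤ d) {s : Shape} (h : componentProj d s ≠ 0) :
    (rho d s).trace = 1 := by
  rw [rho, Matrix.trace_smul, smul_eq_mul]
  exact inv_mul_cancel₀ fun h0 => h (componentProj_eq_zero hd h0)

lemma trace_componentProj_mul_rho {d : ℕ} (hd : 2 ≤ d) (s t : Shape) :
    (componentProj d s * rho d t).trace = if s = t ∧ componentProj d s ≠ 0 then 1 else 0 := by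
  rw [rho, Matrix.mul_smul, Matrix.trace_smul]
  by_cases hst : s = t
  · subst hst
    rw [componentProj_mul_self hd]
    by_cases h : componentProj d s = 0
    · simp [h]
    · rw [if_pos ⟨rfl, h⟩]
      exact inv_mul_cancel₀ fun h0 => h (componentProj_eq_zero hd h0)
  · rw [componentProj_mul_of_ne hd hst, if_neg fun h => hst h.1, Matrix.trace_zero, smul_zero]

/-- Matrices on `A B A' B'` that are supported on `∧² ⊗ ∧²` and commute with the representation. -/
structure IsSiteInvariant {d : ℕ} (X : Matrix (Quad d) (Quad d) ℂ) : Prop where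
  col : ∀ z, IsBiAntisymm fun x => X x z
  row : ∀ x, IsBiAntisymm fun z => X x z
  comm : ∀ g ∈ Matrix.unitaryGroup (Fin d) ℂ, X * fourFold g = fourFold g * X

lemma toEuclideanLin_mem_of_col {d : ℕ} {X : Matrix (Quad d) (Quad d) ℂ}
    (h : ∀ z, IsBiAntisymm fun x => X x z) (v : EuclideanSpace ℂ (Quad d)) :
    Matrix.toEuclideanLin X v ∈ wedgeTensorWedge d := by
  rw [mem_wedgeTensorWedge]
  simp only [IsBiAntisymm, Matrix.ofLp_toLpLin, Matrix.toLin'_apply, Matrix.mulVec, dotProduct,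
    ← Finset.sum_neg_distrib, ← neg_mul]
  exact ⟨fun a b y => Finset.sum_congr rfl fun z _ => congrArg (· * v z) ((h z).1 a b y),
    fun y a b => Finset.sum_congr rfl fun z _ => congrArg (· * v z) ((h z).2 y a b)⟩

lemma toEuclideanLin_eq_zero_of_row {d : ℕ} {X : Matrix (Quad d) (Quad d) ℂ}
    (h : ∀ x, IsBiAntisymm fun z => X x z) {v : EuclideanSpace ℂ (Quad d)}
    (hv : v ∈ (wedgeTensorWedge d)ᗮ) : Matrix.toEuclideanLin X v = 0 := by
  ext x
  have hmem : (WithLp.toLp 2 fun z => conj (X x z) : EuclideanSpace ℂ (Quad d)) ∈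
      wedgeTensorWedge d := by
    rw [mem_wedgeTensorWedge]
    exact ⟨fun a b y => (congrArg conj ((h x).1 a b y)).trans (map_neg _ _),
      fun y a b => (congrArg conj ((h x).2 y a b)).trans (map_neg _ _)⟩
  have h0 := (Submodule.mem_orthogonal _ _).mp hv _ hmem
  rw [PiLp.inner_apply] at h0
  simp only [RCLike.inner_apply, Complex.conj_conj] at h0
  simp only [Matrix.ofLp_toLpLin, Matrix.toLin'_apply, Matrix.mulVec, dotProduct, PiLp.zero_apply]
  rw [← h0]
  exact Finset.sum_congr rfl fun z _ => mul_comm _ _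

/-- Invariant matrices are combinations of the normalised projectors, and pairing with the
projectors gives the coefficients. -/
theorem IsSiteInvariant.eq_sum {d : ℕ} (hd : 2 ≤ d) {X : Matrix (Quad d) (Quad d) ℂ}
    (hX : IsSiteInvariant X) : X = ∑ s, (componentProj d s * X).trace • rho d s := by
  obtain ⟨α, β, γ, hc⟩ := exists_scalar hd hX.comm
    (fun v _ => toEuclideanLin_mem_of_col hX.col v)
  have key : X = ∑ s, exchangeScalar α β γ s • componentProj d s := by
    apply Matrix.toEuclideanLin.injective
    refine LinearMap.ext fun v => ?_
    simp only [map_sum, map_smul, LinearMap.sum_apply, LinearMap.smul_apply,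
      toEuclideanLin_componentProj hd]
    obtain ⟨y, hy, z, hz, rfl⟩ := (wedgeTensorWedge d).exists_add_mem_mem_orthogonal v
    obtain ⟨w, hw, rfl⟩ := exists_decomposition hy
    rw [map_add, toEuclideanLin_eq_zero_of_row hX.row hz, add_zero, map_sum]
    refine Finset.sum_congr rfl fun s _ => ?_
    rw [hc s _ (hw s)]
    congr 1
    rw [ContinuousLinearMap.coe_coe, map_add, map_sum,
      ((shapeSpace d s).starProjection_apply_eq_zero_iff).mpr
        (Submodule.orthogonal_le (shapeSpace_le d s) hz), add_zero,
      Finset.sum_eq_single s, Submodule.starProjection_eq_self_iff.mpr (hw s)]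
    · exact fun t _ hts => starProjection_shapeSpace_of_ne hd hts.symm (hw t)
    · simp
  nth_rewrite 1 [key]
  refine Finset.sum_congr rfl fun s _ => ?_
  have h : componentProj d s * X = exchangeScalar α β γ s • componentProj d s := by
    rw [key, Finset.mul_sum, Finset.sum_eq_single s]
    · rw [Matrix.mul_smul, componentProj_mul_self hd]
    · intro t _ hts
      rw [Matrix.mul_smul, componentProj_mul_of_ne hd hts.symm, smul_zero]
    · simp
  rw [h, Matrix.trace_smul, rho, smul_smul, smul_eq_mul]
  by_cases h0 : (componentProj d s).trace = 0
  · rw [componentProj_eq_zero hd h0, smul_zero, smul_zero]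
  · rw [mul_assoc, mul_inv_cancel₀ h0, mul_one]

lemma rho_col {d : ℕ} (hd : 2 ≤ d) (s : Shape) (z : Quad d) :
    IsBiAntisymm fun x => rho d s x z := by
  have h1 : (fun x => rho d s x z) =
      Matrix.toEuclideanLin (rho d s) (EuclideanSpace.single z 1) := by
    ext x
    simp [Matrix.toLin'_apply]
  rw [h1, ← mem_wedgeTensorWedge, rho, map_smul, LinearMap.smul_apply,
    toEuclideanLin_componentProj hd]
  exact Submodule.smul_mem _ _ (shapeSpace_le d s (Submodule.starProjection_apply_mem _ _))

/-! ### Products over the sites -/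

section Sites

variable {ι : Type*} {n : ℕ}

/-- The tensor product of one matrix for each site. -/
def prodMatrix (P : Fin n → Matrix ι ι ℂ) : Matrix (Fin n → ι) (Fin n → ι) ℂ :=
  Matrix.of fun x z => ∏ i, P i (x i) (z i)

lemma prodMatrix_apply (P : Fin n → Matrix ι ι ℂ) (x z : Fin n → ι) :
    prodMatrix P x z = ∏ i, P i (x i) (z i) := rfl

/-- The matrix of site `i` that remains when the labels of all other sites are fixed. -/
def siteSlice (Ω : Matrix (Fin n → ι) (Fin n → ι) ℂ) (i : Fin n) (x z : Fin n → ι) :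
    Matrix ι ι ℂ :=
  Matrix.of fun a b => Ω (Function.update x i a) (Function.update z i b)

lemma prodMatrix_mul [Fintype ι] (P Q : Fin n → Matrix ι ι ℂ) :
    prodMatrix P * prodMatrix Q = prodMatrix fun i => P i * Q i := by
  ext x z
  simp only [Matrix.mul_apply, prodMatrix_apply, ← Finset.prod_mul_distrib, Finset.prod_univ_sum,
    Fintype.piFinset_univ]

lemma trace_prodMatrix [Fintype ι] (P : Fin n → Matrix ι ι ℂ) :
    (prodMatrix P).trace = ∏ i, (P i).trace := by
  simp only [Matrix.trace, Matrix.diag_apply, prodMatrix_apply, Finset.prod_univ_sum,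
    Fintype.piFinset_univ]

lemma prodMatrix_conjTranspose (P : Fin n → Matrix ι ι ℂ) :
    (prodMatrix P).conjTranspose = prodMatrix fun i => (P i).conjTranspose := by
  ext x z
  simp only [Matrix.conjTranspose_apply, prodMatrix_apply, star_prod]

lemma prodMatrix_one [DecidableEq ι] :
    prodMatrix (fun _ : Fin n => (1 : Matrix ι ι ℂ)) = 1 := by
  ext x z
  simp only [prodMatrix_apply, Matrix.one_apply, Finset.prod_boole, Finset.mem_univ, true_imp_iff,
    funext_iff]

/-- If all slices of `Ω` lie in the span of the matrices `P s`, with coefficients given by linear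
functionals, then `Ω` lies in the span of their tensor products. -/
lemma mem_span_prodMatrix [Fintype ι] [DecidableEq ι] {S : Type*} [Fintype S]
    {T : Set (Matrix ι ι ℂ)} (P : S → Matrix ι ι ℂ) (f : S → Matrix ι ι ℂ →ₗ[ℂ] ℂ)
    (hT : ∀ X ∈ T, X = ∑ s, f s X • P s) {n : ℕ} (Ω : Matrix (Fin n → ι) (Fin n → ι) ℂ)
    (hΩ : ∀ i x z, siteSlice Ω i x z ∈ T) :
    Ω ∈ Submodule.span ℂ (Set.range fun y : Fin n → S => prodMatrix fun i => P (y i)) := by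
  induction n with
  | zero =>
    have : Ω = Ω default default • prodMatrix fun i => P ((default : Fin 0 → S) i) := by
      ext x z
      simp [prodMatrix_apply, Subsingleton.elim x default, Subsingleton.elim z default]
    rw [this]
    exact Submodule.smul_mem _ _ (Submodule.subset_span ⟨_, rfl⟩)
  | succ n ih =>
    let Ωab : ι → ι → Matrix (Fin n → ι) (Fin n → ι) ℂ := fun a b =>
      Matrix.of fun x z => Ω (Fin.cons a x) (Fin.cons b z)
    have hΩab : ∀ a b, Ωab a b ∈
        Submodule.span ℂ (Set.range fun y : Fin n → S => prodMatrix fun i => P (y i)) := by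
      intro a b
      refine ih _ fun i x z => ?_
      have : siteSlice (Ωab a b) i x z = siteSlice Ω i.succ (Fin.cons a x) (Fin.cons b z) := by
        ext c e
        simp only [siteSlice, Ωab, Matrix.of_apply, Fin.cons_update]
      rw [this]
      exact hΩ _ _ _
    let X : (Fin n → ι) → (Fin n → ι) → Matrix ι ι ℂ := fun x z =>
      Matrix.of fun a b => Ω (Fin.cons a x) (Fin.cons b z)
    -- the coefficients of the slices at the first site, as matrices on the remaining sites
    let R : S → Matrix (Fin n → ι) (Fin n → ι) ℂ := fun s => Matrix.of fun x z => f s (X x z)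
    have hR : ∀ s, R s ∈
        Submodule.span ℂ (Set.range fun y : Fin n → S => prodMatrix fun i => P (y i)) := by
      intro s
      have : R s = ∑ a, ∑ b, f s (Matrix.single a b 1) • Ωab a b := by
        ext x z
        simp only [R, Matrix.of_apply, Matrix.sum_apply, Matrix.smul_apply, smul_eq_mul]
        conv_lhs => rw [Matrix.matrix_eq_sum_single (X x z)]
        simp only [map_sum]
        refine Finset.sum_congr rfl fun a _ => Finset.sum_congr rfl fun b _ => ?_
        rw [← mul_one (X x z a b), ← smul_eq_mul, ← Matrix.smul_single, map_smul, smul_eq_mul,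
          mul_comm]
        rfl
      rw [this]
      exact Submodule.sum_mem _ fun a _ => Submodule.sum_mem _ fun b _ =>
        Submodule.smul_mem _ _ (hΩab a b)
    let Lift : S → Matrix (Fin n → ι) (Fin n → ι) ℂ →ₗ[ℂ]
        Matrix (Fin (n + 1) → ι) (Fin (n + 1) → ι) ℂ := fun s =>
      { toFun := fun M => Matrix.of fun x z => P s (x 0) (z 0) * M (Fin.tail x) (Fin.tail z)
        map_add' := fun M N => by
          ext x z
          simp only [Matrix.of_apply, Matrix.add_apply]
          ring
        map_smul' := fun c M => by
          ext x z
          simp only [Matrix.of_apply, Matrix.smul_apply, smul_eq_mul, RingHom.id_apply]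
          ring }
    have hLift : ∀ s, ∀ M ∈
        Submodule.span ℂ (Set.range fun y : Fin n → S => prodMatrix fun i => P (y i)),
        Lift s M ∈ Submodule.span ℂ
          (Set.range fun y : Fin (n + 1) → S => prodMatrix fun i => P (y i)) := by
      intro s M hM
      refine Submodule.span_induction ?_ ?_ ?_ ?_ hM
      · rintro _ ⟨y, rfl⟩
        refine Submodule.subset_span ⟨Fin.cons s y, ?_⟩
        ext x z
        simp only [prodMatrix_apply, Fin.prod_univ_succ, Fin.cons_zero, Fin.cons_succ]
        rfl
      · rw [map_zero]
        exact Submodule.zero_mem _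
      · intro A B _ _ hA hB
        rw [map_add]
        exact Submodule.add_mem _ hA hB
      · intro c A _ hA
        rw [map_smul]
        exact Submodule.smul_mem _ _ hA
    have hsum : Ω = ∑ s, Lift s (R s) := by
      ext x z
      have hX : X (Fin.tail x) (Fin.tail z) ∈ T := by
        have : X (Fin.tail x) (Fin.tail z) = siteSlice Ω 0 x z := by
          ext a b
          simp only [X, siteSlice, Matrix.of_apply]
          rw [← Fin.cons_self_tail x, ← Fin.cons_self_tail z]
          simp only [Fin.update_cons_zero, Fin.tail_cons]
        rw [this]
        exact hΩ _ _ _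
      have h := congrFun (congrFun (hT _ hX) (x 0)) (z 0)
      simp only [X, Matrix.of_apply, Fin.cons_self_tail] at h
      rw [h, Matrix.sum_apply, Matrix.sum_apply]
      exact Finset.sum_congr rfl fun s _ => mul_comm _ _
    rw [hsum]
    exact Submodule.sum_mem _ fun s _ => hLift s _ (hR s)

end Sites

/-- The coefficients of an operator in the span of the products of normalised projectors are its
traces against the products of projectors. Products with a vanishing factor get the weight `0`. -/
lemma eq_sum_trace_of_mem_span {n d : ℕ} (hd : 2 ≤ d)
    {Ω : Matrix (Fin n → Quad d) (Fin n → Quad d) ℂ}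
    (hΩ : Ω ∈ Submodule.span ℂ
      (Set.range fun y : Fin n → Shape => prodMatrix fun i => rho d (y i))) :
    Ω = ∑ y : Fin n → Shape, ((prodMatrix fun i => componentProj d (y i)) * Ω).trace •
      prodMatrix fun i => rho d (y i) := by
  induction hΩ using Submodule.span_induction with
  | mem A hA =>
    obtain ⟨y, rfl⟩ := hA
    by_cases h0 : ∃ i, componentProj d (y i) = 0
    · obtain ⟨i, hi⟩ := h0
      have : (prodMatrix fun i => rho d (y i)) = 0 := by
        ext x z
        rw [prodMatrix_apply, Finset.prod_eq_zero (Finset.mem_univ i), Matrix.zero_apply]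
        simp [rho, hi]
      simp [this]
    · push Not at h0
      rw [Finset.sum_eq_single y]
      · rw [prodMatrix_mul, trace_prodMatrix, Finset.prod_eq_one, one_smul]
        intro i _
        rw [trace_componentProj_mul_rho hd, if_pos ⟨rfl, h0 i⟩]
      · intro t _ hty
        obtain ⟨i, hi⟩ := Function.ne_iff.mp hty
        rw [prodMatrix_mul, trace_prodMatrix, Finset.prod_eq_zero (Finset.mem_univ i), zero_smul]
        rw [trace_componentProj_mul_rho hd, if_neg fun h => hi h.1]
      · simp
  | zero => simp
  | add A B _ _ hA hB =>
    simp only [Matrix.mul_add, Matrix.trace_add, add_smul, Finset.sum_add_distrib]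
    rw [← hA, ← hB]
  | smul c A _ hA =>
    simp only [Matrix.mul_smul, Matrix.trace_smul, smul_assoc, ← Finset.smul_sum]
    rw [← hA]

/-- A state all of whose slices are supported on `∧² ⊗ ∧²` and commute with the representation is a
mixture of products of the normalised projectors. -/
theorem exists_mixture {n d : ℕ} (hd : 2 ≤ d)
    {Ω : Matrix (Fin n → Quad d) (Fin n → Quad d) ℂ} (hstate : IsState Ω)
    (hΩ : ∀ i x z, IsSiteInvariant (siteSlice Ω i x z)) :
    ∃ p : (Fin n → Shape) → ℝ, (∀ y, 0 ≤ p y) ∧ ∑ y, p y = 1 ∧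
      Ω = ∑ y, (p y : ℂ) • prodMatrix fun i => rho d (y i) := by
  have hspan := mem_span_prodMatrix (T := {X | IsSiteInvariant X}) (rho d)
    (fun s => (Matrix.traceLinearMap _ ℂ ℂ).comp (LinearMap.mulLeft ℂ (componentProj d s)))
    (fun X hX => IsSiteInvariant.eq_sum hd hX) Ω hΩ
  have hsum := eq_sum_trace_of_mem_span hd hspan
  let P : (Fin n → Shape) → Matrix (Fin n → Quad d) (Fin n → Quad d) ℂ :=
    fun y => prodMatrix fun i => componentProj d (y i)
  have hPh : ∀ y, (P y).conjTranspose = P y := fun y => by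
    simp only [P, prodMatrix_conjTranspose, (componentProj_isHermitian d _).eq]
  have hPP : ∀ y, P y * P y = P y := fun y => by
    simp only [P, prodMatrix_mul, componentProj_mul_self hd]
  have hnonneg : ∀ y, 0 ≤ (P y * Ω).trace := by
    intro y
    have h : (P y * Ω).trace = ((P y).conjTranspose * Ω * P y).trace := by
      rw [hPh, Matrix.mul_assoc, Matrix.trace_mul_comm (P y) (Ω * P y), Matrix.mul_assoc, hPP,
        Matrix.trace_mul_comm]
    rw [h]
    exact (hstate.1.conjTranspose_mul_mul_same (P y)).trace_nonneg
  have hreal : ∀ y, (((P y * Ω).trace.re : ℝ) : ℂ) = (P y * Ω).trace := fun y =>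
    (Complex.eq_re_of_ofReal_le (hnonneg y)).symm
  have hΩ' : Ω = ∑ y, (((P y * Ω).trace.re : ℝ) : ℂ) • prodMatrix fun i => rho d (y i) := by
    simp only [hreal]
    exact hsum
  refine ⟨fun y => (P y * Ω).trace.re, fun y => (Complex.nonneg_iff.mp (hnonneg y)).1, ?_, hΩ'⟩
  have htr := hstate.2
  rw [hsum, Matrix.trace_sum] at htr
  have hterm : ∀ y, ((P y * Ω).trace • prodMatrix fun i => rho d (y i)).trace =
      (P y * Ω).trace := by
    intro y
    rw [Matrix.trace_smul, trace_prodMatrix, smul_eq_mul]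
    by_cases h0 : ∃ i, componentProj d (y i) = 0
    · obtain ⟨i, hi⟩ := h0
      have : P y = 0 := by
        ext x z
        simp only [P]
        rw [prodMatrix_apply, Finset.prod_eq_zero (Finset.mem_univ i), Matrix.zero_apply]
        simp [hi]
      rw [this, Matrix.zero_mul, Matrix.trace_zero, zero_mul]
    · push Not at h0
      rw [Finset.prod_eq_one fun i _ => trace_rho hd (h0 i), mul_one]
  rw [Finset.sum_congr rfl fun y _ => hterm y] at htr
  have := congrArg Complex.re htr
  rwa [Complex.re_sum, Complex.one_re] at this

/-! ### Operators on one site -/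

/-- The operator `K` on site `i`, and the identity elsewhere. -/
def atSite {ι : Type*} [DecidableEq ι] {n : ℕ} (i : Fin n) (K : Matrix ι ι ℂ) :
    Matrix (Fin n → ι) (Fin n → ι) ℂ :=
  prodMatrix (Function.update (fun _ => 1) i K)

lemma sum_atSite {ι : Type*} [Fintype ι] [DecidableEq ι] {n : ℕ} (i : Fin n) (K : Matrix ι ι ℂ)
    (x : Fin n → ι) (F : (Fin n → ι) → ℂ) :
    ∑ w, atSite i K x w * F w = ∑ a, K (x i) a * F (Function.update x i a) := by
  have hinj : Function.Injective fun a : ι => Function.update x i a :=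
    Function.update_injective x i
  have hval : ∀ a, atSite i K x (Function.update x i a) = K (x i) a := by
    intro a
    rw [atSite, prodMatrix_apply, Finset.prod_eq_single i]
    · simp
    · intro j _ hj
      simp [hj]
    · simp
  symm
  refine Finset.sum_of_injOn (fun a => Function.update x i a) hinj.injOn (by simp) ?_ ?_
  · intro w _ hw
    have : ∃ j, j ≠ i ∧ x j ≠ w j := by
      by_contra! h
      refine hw ⟨w i, by simp, ?_⟩
      ext j
      by_cases hj : j = i
      · subst hj
        simp
      · simp [hj, h j hj]
    obtain ⟨j, hj, hjx⟩ := this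
    rw [atSite, prodMatrix_apply, Finset.prod_eq_zero (Finset.mem_univ j), zero_mul]
    simp [hj, hjx]
  · intro a _
    rw [hval]

lemma sum_atSite' {ι : Type*} [Fintype ι] [DecidableEq ι] {n : ℕ} (i : Fin n) (K : Matrix ι ι ℂ)
    (x : Fin n → ι) (F : (Fin n → ι) → ℂ) :
    ∑ w, F w * atSite i K w x = ∑ a, F (Function.update x i a) * K a (x i) := by
  have htr : ∀ w, atSite i K w x = atSite i K.transpose x w := by
    intro w
    simp only [atSite, prodMatrix_apply]
    refine Finset.prod_congr rfl fun j _ => ?_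
    by_cases hj : j = i
    · subst hj
      simp
    · simp [hj, Matrix.one_apply, eq_comm]
  simp only [htr, mul_comm (F _)]
  rw [sum_atSite]
  rfl

lemma siteSlice_comm {ι : Type*} [Fintype ι] [DecidableEq ι] {n : ℕ} {i : Fin n}
    {K : Matrix ι ι ℂ} {Ω : Matrix (Fin n → ι) (Fin n → ι) ℂ} (h : Ω * atSite i K = atSite i K * Ω)
    (x z : Fin n → ι) : siteSlice Ω i x z * K = K * siteSlice Ω i x z := by
  ext a b
  have h1 := congrFun (congrFun h (Function.update x i a)) (Function.update z i b)
  simp only [Matrix.mul_apply, sum_atSite, sum_atSite', Function.update_self,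
    Function.update_idem] at h1
  simpa only [Matrix.mul_apply, siteSlice, Matrix.of_apply] using h1

/-! ### Antisymmetric vectors on several pairs -/

/-- The labels of `A^n B^n`, grouped by sites. -/
def pairEquiv (n d : ℕ) : Word n d × Word n d ≃ (Fin n → Pair d) where
  toFun x i := pairAt x i
  invFun f := (fun i => (f i).1, fun i => (f i).2)
  left_inv _ := rfl
  right_inv _ := rfl

lemma pairEquiv_symm_apply {n d : ℕ} (f : Fin n → Pair d) :
    (pairEquiv n d).symm f = (fun i => (f i).1, fun i => (f i).2) := rfl

/-- The labels of `A^n B^n A'^n B'^n`, grouped by sites. -/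
def quadEquiv (n d : ℕ) :
    (Word n d × Word n d) × (Word n d × Word n d) ≃ (Fin n → Quad d) where
  toFun x i := quadAt x i
  invFun f := ((fun i => (f i).1.1, fun i => (f i).1.2), (fun i => (f i).2.1, fun i => (f i).2.2))
  left_inv _ := rfl
  right_inv _ := rfl

/-- The exchange of the letters of `A_i` and `B_i`. -/
def swapAt {n d : ℕ} (i : Fin n) (x : Word n d × Word n d) : Word n d × Word n d :=
  (Function.update x.1 i (x.2 i), Function.update x.2 i (x.1 i))

lemma swapAt_involutive {n d : ℕ} (i : Fin n) :
    Function.Involutive (swapAt i : Word n d × Word n d → _) := by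
  intro x
  simp [swapAt]

lemma pairAt_swapAt_self {n d : ℕ} (i : Fin n) (x : Word n d × Word n d) :
    pairAt (swapAt i x) i = (x.2 i, x.1 i) := by
  simp [pairAt, swapAt]

lemma pairAt_swapAt_of_ne {n d : ℕ} {i j : Fin n} (hj : j ≠ i) (x : Word n d × Word n d) :
    pairAt (swapAt i x) j = pairAt x j := by
  simp [pairAt, swapAt, hj]

/-- Antisymmetry in each of the pairs `A_i B_i`. -/
def IsAntisymm {n d : ℕ} (ψ : Word n d × Word n d → ℂ) : Prop :=
  ∀ i x, ψ (swapAt i x) = -ψ x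

/-- Twice the projector onto `∧²`. -/
def antisymmetrizer (d : ℕ) : Matrix (Pair d) (Pair d) ℂ :=
  Matrix.of fun x y => (if y = x then 1 else 0) - if y = x.swap then 1 else 0

lemma prodMatrix_antisymmetrizer_mulVec {n d : ℕ} {ψ : (Fin n → Pair d) → ℂ}
    (hψ : ∀ i x, ψ (Function.update x i (x i).swap) = -ψ x) :
    (prodMatrix fun _ : Fin n => antisymmetrizer d).mulVec ψ = (2 ^ n : ℂ) • ψ := by
  have hsite : ∀ i, (atSite i (antisymmetrizer d)).mulVec ψ = (2 : ℂ) • ψ := by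
    intro i
    ext x
    simp only [Matrix.mulVec, dotProduct, sum_atSite, antisymmetrizer, Matrix.of_apply, sub_mul,
      Finset.sum_sub_distrib, ite_mul, one_mul, zero_mul, Finset.sum_ite_eq', Finset.mem_univ,
      if_true, Function.update_eq_self, hψ, Pi.smul_apply, smul_eq_mul]
    ring
  have hS : ∀ S : Finset (Fin n),
      (prodMatrix fun i : Fin n => if i ∈ S then antisymmetrizer d else 1).mulVec ψ =
        (2 ^ S.card : ℂ) • ψ := by
    intro S
    induction S using Finset.induction_on with
    | empty => simp [prodMatrix_one]
    | insert i S hi ih =>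
      have : (prodMatrix fun j : Fin n => if j ∈ insert i S then antisymmetrizer d else 1) =
          (prodMatrix fun j : Fin n => if j ∈ S then antisymmetrizer d else 1) *
            atSite i (antisymmetrizer d) := by
        rw [atSite, prodMatrix_mul]
        congr 1
        ext1 j
        by_cases hj : j = i
        · subst hj
          simp [hi]
        · simp [hj]
      rw [this, ← Matrix.mulVec_mulVec, hsite, Matrix.mulVec_smul, ih,
        Finset.card_insert_of_notMem hi, smul_smul, pow_succ, mul_comm]
  have := hS Finset.univ
  simpa using this

/-- The tensor power of the antisymmetric subspace, given as a span of product vectors, consists of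
all vectors that are antisymmetric in each pair: the tensor power of the antisymmetriser fixes such
a vector up to the factor `2 ^ n`, and its columns are product vectors. -/
lemma mem_wedgePow {n d : ℕ} {ψ : EuclideanSpace ℂ (Word n d × Word n d)} :
    ψ ∈ wedgePow n d ↔ IsAntisymm ψ := by
  constructor
  · intro h
    induction h using Submodule.span_induction with
    | mem ψ hψ =>
      obtain ⟨v, hv, h⟩ := hψ
      intro i x
      rw [h, h, ← Finset.mul_prod_erase _ _ (Finset.mem_univ i),
        ← Finset.mul_prod_erase _ (fun j => v j (pairAt x j)) (Finset.mem_univ i),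
        pairAt_swapAt_self, hv i (x.1 i) (x.2 i), neg_mul]
      congr 2
      refine Finset.prod_congr rfl fun j hj => ?_
      rw [pairAt_swapAt_of_ne (Finset.ne_of_mem_erase hj)]
    | zero => intro i x; simp
    | add a b _ _ ha hb =>
      intro i x
      simp only [PiLp.add_apply, ha i x, hb i x]
      ring
    | smul c a _ ha =>
      intro i x
      simp only [PiLp.smul_apply, ha i x, smul_eq_mul]
      ring
  · intro hψ
    have key := prodMatrix_antisymmetrizer_mulVec (ψ := fun f => ψ ((pairEquiv n d).symm f))
      (fun i f => by
        have hf : (pairEquiv n d).symm (Function.update f i (f i).swap) =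
            swapAt i ((pairEquiv n d).symm f) := by
          apply Prod.ext <;>
          · funext j
            by_cases hj : j = i
            · subst hj
              simp [pairEquiv_symm_apply, swapAt]
            · simp [pairEquiv_symm_apply, swapAt, hj]
        simp only [hf]
        exact hψ i _)
    have hsum : ψ = (2 ^ n : ℂ)⁻¹ • ∑ f : Fin n → Pair d, ψ ((pairEquiv n d).symm f) •
        (WithLp.toLp 2 fun x => ∏ i, antisymmetrizer d (pairAt x i) (f i) :
          EuclideanSpace ℂ (Word n d × Word n d)) := by
      ext x
      have h := congrFun key (pairEquiv n d x)
      simp only [Matrix.mulVec, dotProduct, Pi.smul_apply, smul_eq_mul,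
        Equiv.symm_apply_apply] at h
      simp only [PiLp.smul_apply, WithLp.ofLp_sum, Finset.sum_apply, smul_eq_mul]
      rw [eq_inv_mul_iff_mul_eq₀ (pow_ne_zero _ two_ne_zero), ← h]
      exact Finset.sum_congr rfl fun f _ => mul_comm _ _
    rw [hsum]
    refine Submodule.smul_mem _ _ (Submodule.sum_mem _ fun f _ => Submodule.smul_mem _ _
      (Submodule.subset_span ⟨fun i => WithLp.toLp 2 fun y => antisymmetrizer d y (f i), ?_,
        fun x => rfl⟩))
    intro i a b
    simp only [antisymmetrizer, Matrix.of_apply, Prod.swap_prod_mk]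
    ring

/-! ### Purity and the flip operator -/

/-- The coefficients of a bipartite vector, as a matrix. -/
def coeffMatrix {α : Type*} (ψ : EuclideanSpace ℂ (α × α)) : Matrix α α ℂ :=
  Matrix.of fun a b => ψ (a, b)

lemma traceSecond_ketBra {α : Type*} [Fintype α] (ψ : EuclideanSpace ℂ (α × α)) :
    traceSecond (ketBra ψ) = coeffMatrix ψ * (coeffMatrix ψ).conjTranspose := by
  ext a c
  simp [traceSecond, ketBra, coeffMatrix, Matrix.mul_apply]

lemma traceSecond_ketBra_isHermitian {α : Type*} [Fintype α] (ψ : EuclideanSpace ℂ (α × α)) :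
    (traceSecond (ketBra ψ)).IsHermitian := by
  rw [traceSecond_ketBra]
  exact Matrix.isHermitian_mul_conjTranspose_self _

lemma flipValue_kronecker {n d : ℕ}
    (σ ω : Matrix (Word n d × Word n d) (Word n d × Word n d) ℂ) :
    flipValue (σ ⊗ₖ ω) = ((traceSecond σ * traceSecond ω).trace).re := by
  have hred : reduceAA (σ ⊗ₖ ω) = traceSecond σ ⊗ₖ traceSecond ω := by
    ext r c
    simp only [reduceAA, traceSecond, Matrix.of_apply, Matrix.kroneckerMap_apply,
      Finset.sum_mul_sum]
  rw [flipValue, hred]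
  congr 1
  simp only [Matrix.trace, Matrix.diag_apply, Matrix.mul_apply, flip, Matrix.of_apply,
    mul_ite, mul_one, mul_zero, Finset.sum_ite_eq', Finset.mem_univ, if_true,
    Matrix.kroneckerMap_apply, Fintype.sum_prod_type]

lemma flipValue_ketBra {n d : ℕ} (ψ : EuclideanSpace ℂ (Word n d × Word n d)) :
    flipValue (ketBra ψ ⊗ₖ ketBra ψ) = purity ψ := by
  rw [flipValue_kronecker, purity, sq]

/-- `2 tr(ab) ≤ tr(a²) + tr(b²)` for the Hermitian reductions. -/
lemma flipValue_ketBra_le {n d : ℕ} (φ χ : EuclideanSpace ℂ (Word n d × Word n d)) :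
    flipValue (ketBra φ ⊗ₖ ketBra χ) ≤ (purity φ + purity χ) / 2 := by
  rw [flipValue_kronecker, purity, purity]
  set a := traceSecond (ketBra φ) with ha
  set b := traceSecond (ketBra χ) with hb
  have hab : (a - b).IsHermitian :=
    (traceSecond_ketBra_isHermitian φ).sub (traceSecond_ketBra_isHermitian χ)
  have h := (Matrix.posSemidef_conjTranspose_mul_self (a - b)).trace_nonneg
  rw [hab.eq, Matrix.sub_mul, Matrix.mul_sub, Matrix.mul_sub, Matrix.trace_sub, Matrix.trace_sub,
    Matrix.trace_sub, Matrix.trace_mul_comm b a] at h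
  have h' := (Complex.nonneg_iff.mp h).1
  simp only [Complex.sub_re] at h'
  rw [sq, sq]
  linarith

lemma trace_ketBra {ι : Type*} [Fintype ι] (ψ : EuclideanSpace ℂ ι) :
    (ketBra ψ).trace = ((‖ψ‖ ^ 2 : ℝ) : ℂ) := by
  rw [EuclideanSpace.norm_sq_eq]
  simp only [Matrix.trace, Matrix.diag_apply, ketBra, Matrix.of_apply, Complex.mul_conj,
    Complex.normSq_eq_norm_sq, Complex.ofReal_sum]

lemma norm_eq_one_iff_trace {ι : Type*} [Fintype ι] (ψ : EuclideanSpace ℂ ι) :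
    ‖ψ‖ = 1 ↔ (ketBra ψ).trace = 1 := by
  rw [trace_ketBra, Complex.ofReal_eq_one, pow_eq_one_iff_of_nonneg (norm_nonneg ψ) two_ne_zero]

lemma ketBra_eq_vecMulVec {ι : Type*} (ψ : EuclideanSpace ℂ ι) :
    ketBra ψ = Matrix.vecMulVec ψ (star ψ.ofLp) := rfl

lemma isState_ketBra {ι : Type*} [Fintype ι] {ψ : EuclideanSpace ℂ ι} (h : ‖ψ‖ = 1) :
    IsState (ketBra ψ) :=
  ⟨by rw [ketBra_eq_vecMulVec]; exact Matrix.posSemidef_vecMulVec_self_star _,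
    (norm_eq_one_iff_trace ψ).mp h⟩

/-! ### Local symmetries -/

/-- The action of a matrix on a vector. -/
def actOn {ι : Type*} [Fintype ι] (u : Matrix ι ι ℂ) (ψ : EuclideanSpace ℂ ι) :
    EuclideanSpace ℂ ι := WithLp.toLp 2 (u.mulVec ψ)

lemma ketBra_actOn {ι : Type*} [Fintype ι] (u : Matrix ι ι ℂ) (ψ : EuclideanSpace ℂ ι) :
    ketBra (actOn u ψ) = u * ketBra ψ * u.conjTranspose := by
  rw [ketBra_eq_vecMulVec, ketBra_eq_vecMulVec, Matrix.mul_vecMulVec, Matrix.vecMulVec_mul,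
    ← Matrix.star_mulVec]
  rfl

lemma norm_actOn {ι : Type*} [Fintype ι] [DecidableEq ι] {u : Matrix ι ι ℂ}
    (hu : u.conjTranspose * u = 1) {ψ : EuclideanSpace ℂ ι} (h : ‖ψ‖ = 1) : ‖actOn u ψ‖ = 1 := by
  rw [norm_eq_one_iff_trace] at h ⊢
  rw [ketBra_actOn, Matrix.trace_mul_comm, ← Matrix.mul_assoc, hu, Matrix.one_mul, h]

lemma coeffMatrix_actOn {α : Type*} [Fintype α] (U : Matrix α α ℂ)
    (ψ : EuclideanSpace ℂ (α × α)) :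
    coeffMatrix (actOn (U ⊗ₖ U) ψ) = U * coeffMatrix ψ * U.transpose := by
  ext a b
  simp only [coeffMatrix, actOn, Matrix.of_apply, Matrix.mulVec, dotProduct,
    Matrix.kroneckerMap_apply, Fintype.sum_prod_type, Matrix.mul_apply, Matrix.transpose_apply,
    Finset.sum_mul]
  rw [Finset.sum_comm]
  refine Finset.sum_congr rfl fun i _ => Finset.sum_congr rfl fun j _ => ?_
  ring

lemma traceSecond_ketBra_actOn {α : Type*} [Fintype α] [DecidableEq α] {U : Matrix α α ℂ}
    (hU : U.conjTranspose * U = 1) (ψ : EuclideanSpace ℂ (α × α)) :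
    traceSecond (ketBra (actOn (U ⊗ₖ U) ψ)) =
      U * traceSecond (ketBra ψ) * U.conjTranspose := by
  have hT : U.transpose * U.transpose.conjTranspose = 1 := by
    have := congrArg Matrix.transpose hU
    rwa [Matrix.transpose_mul, Matrix.transpose_one] at this
  rw [traceSecond_ketBra, traceSecond_ketBra, coeffMatrix_actOn, Matrix.conjTranspose_mul,
    Matrix.conjTranspose_mul]
  calc U * coeffMatrix ψ * U.transpose *
        (U.transpose.conjTranspose * ((coeffMatrix ψ).conjTranspose * U.conjTranspose))
      = U * coeffMatrix ψ * (U.transpose * U.transpose.conjTranspose) *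
        ((coeffMatrix ψ).conjTranspose * U.conjTranspose) := by simp only [Matrix.mul_assoc]
    _ = _ := by rw [hT, Matrix.mul_one]; simp only [Matrix.mul_assoc]

lemma flipValue_actOn {n d : ℕ} {U : Matrix (Word n d) (Word n d) ℂ}
    (hU : U.conjTranspose * U = 1) (φ χ : EuclideanSpace ℂ (Word n d × Word n d)) :
    flipValue (ketBra (actOn (U ⊗ₖ U) φ) ⊗ₖ ketBra (actOn (U ⊗ₖ U) χ)) =
      flipValue (ketBra φ ⊗ₖ ketBra χ) := by
  rw [flipValue_kronecker, flipValue_kronecker, traceSecond_ketBra_actOn hU,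
    traceSecond_ketBra_actOn hU]
  congr 1
  set a := traceSecond (ketBra φ)
  set b := traceSecond (ketBra χ)
  calc (U * a * U.conjTranspose * (U * b * U.conjTranspose)).trace
      = (U * (a * (U.conjTranspose * U) * b) * U.conjTranspose).trace := by
        simp only [Matrix.mul_assoc]
    _ = (a * b).trace := by
        rw [hU, Matrix.mul_one, Matrix.trace_mul_comm, ← Matrix.mul_assoc, hU, Matrix.one_mul]

lemma actOn_mem_wedgePow {n d : ℕ} (g : Fin n → Matrix (Fin d) (Fin d) ℂ)
    {ψ : EuclideanSpace ℂ (Word n d × Word n d)} (hψ : ψ ∈ wedgePow n d) :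
    actOn (prodMatrix g ⊗ₖ prodMatrix g) ψ ∈ wedgePow n d := by
  rw [mem_wedgePow] at hψ ⊢
  intro i x
  have hu : ∀ x z, (prodMatrix g ⊗ₖ prodMatrix g) (swapAt i x) (swapAt i z) =
      (prodMatrix g ⊗ₖ prodMatrix g) x z := by
    intro x z
    simp only [Matrix.kroneckerMap_apply, prodMatrix_apply, ← Finset.prod_mul_distrib]
    refine Finset.prod_congr rfl fun j _ => ?_
    by_cases hj : j = i
    · subst hj
      simp [swapAt, mul_comm]
    · simp [swapAt, hj]
  simp only [actOn, Matrix.mulVec, dotProduct]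
  rw [← Equiv.sum_comp (swapAt_involutive i).toPerm, ← Finset.sum_neg_distrib]
  refine Finset.sum_congr rfl fun z _ => ?_
  simp only [Function.Involutive.coe_toPerm, hu, hψ i z, mul_neg]

/-! ### Compact convex sets -/

/-- In finite dimension the convex hull of a compact set is compact: by Carathéodory's theorem it is
the image of a simplex times a power of the set. -/
theorem isCompact_convexHull_of_finiteDimensional {E : Type*} [AddCommGroup E] [Module ℝ E]
    [TopologicalSpace E] [IsTopologicalAddGroup E] [ContinuousSMul ℝ E] [FiniteDimensional ℝ E]
    {s : Set E} (hs : IsCompact s) : IsCompact (convexHull ℝ s) := by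
  obtain rfl | ⟨x₀, hx₀⟩ := s.eq_empty_or_nonempty
  · simp
  let N := Module.finrank ℝ E + 1
  let F : (Fin N → ℝ) × (Fin N → E) → E := fun p => ∑ i, p.1 i • p.2 i
  have hF : Continuous F := by fun_prop
  have hK : IsCompact (stdSimplex ℝ (Fin N) ×ˢ Set.univ.pi fun _ : Fin N => s) :=
    (isCompact_stdSimplex ℝ _).prod (isCompact_univ_pi fun _ => hs)
  convert hK.image hF
  apply Set.Subset.antisymm
  · intro x hx
    obtain ⟨ι, _, z, w, hz, hind, hw, hw1, rfl⟩ := eq_pos_convex_span_of_mem_convexHull hx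
    have hcard : Fintype.card ι ≤ Fintype.card (Fin N) := by
      rw [Fintype.card_fin]
      exact hind.card_le_finrank_succ.trans (Nat.succ_le_succ (Submodule.finrank_le _))
    obtain ⟨e⟩ := Function.Embedding.nonempty_of_card_le hcard
    -- a combination of at most `N` points, padded by zero weights at `x₀`
    have hoff : ∀ (f : ι → E), ∑ j, Function.extend e w 0 j • Function.extend e f (fun _ => x₀) j =
        ∑ i, w i • f i := by
      intro f
      symm
      refine Finset.sum_of_injOn e e.injective.injOn (by simp) ?_ ?_
      · intro j _ hj
        rw [Function.extend_apply' _ _ _ (by simpa using hj), Pi.zero_apply, zero_smul]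
      · intro i _
        rw [e.injective.extend_apply, e.injective.extend_apply]
    refine ⟨(Function.extend e w 0, Function.extend e z fun _ => x₀), ⟨⟨fun j => ?_, ?_⟩, ?_⟩,
      hoff z⟩
    · by_cases hj : ∃ i, e i = j
      · obtain ⟨i, rfl⟩ := hj
        simp only [e.injective.extend_apply]
        exact (hw i).le
      · simp only [Function.extend_apply' _ _ _ hj]
        rfl
    · rw [← hw1]
      symm
      refine Finset.sum_of_injOn e e.injective.injOn (by simp) ?_ ?_
      · intro j _ hj
        exact Function.extend_apply' _ _ _ (by simpa using hj)
      · intro i _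
        exact (e.injective.extend_apply _ _ _).symm
    · intro j _
      by_cases hj : ∃ i, e i = j
      · obtain ⟨i, rfl⟩ := hj
        simp only [e.injective.extend_apply]
        exact hz ⟨i, rfl⟩
      · simp only [Function.extend_apply' _ _ _ hj]
        exact hx₀
  · rintro _ ⟨⟨w, z⟩, ⟨hw, hz⟩, rfl⟩
    exact mem_convexHull_of_exists_fintype w z hw.1 hw.2 (fun i => hz i trivial) rfl

/-- The squared Hilbert–Schmidt norm. -/
def hsNormSq {ι : Type*} [Fintype ι] (X : Matrix ι ι ℂ) : ℝ := ∑ i, ∑ j, Complex.normSq (X i j)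

lemma hsNormSq_eq_trace {ι : Type*} [Fintype ι] (X : Matrix ι ι ℂ) :
    (hsNormSq X : ℂ) = (X.conjTranspose * X).trace := by
  simp only [hsNormSq, Matrix.trace, Matrix.diag_apply, Matrix.mul_apply,
    Matrix.conjTranspose_apply, Complex.ofReal_sum]
  rw [Finset.sum_comm]
  refine Finset.sum_congr rfl fun i _ => Finset.sum_congr rfl fun j _ => ?_
  rw [Complex.normSq_eq_conj_mul_self]
  rfl

/-- A compact convex set of matrices contains a common fixed point of all its self-maps that
preserve the Hilbert–Schmidt norm, namely its point of least norm, which is unique by strict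
convexity. -/
theorem exists_fixed_point {ι : Type*} [Fintype ι] {K : Set (Matrix ι ι ℂ)} (hK : IsCompact K)
    (hconv : Convex ℝ K) (hne : K.Nonempty) :
    ∃ Ω ∈ K, ∀ T : Matrix ι ι ℂ → Matrix ι ι ℂ, Set.MapsTo T K K →
      (∀ X, hsNormSq (T X) = hsNormSq X) → T Ω = Ω := by
  have hcont : Continuous (hsNormSq : Matrix ι ι ℂ → ℝ) := by
    refine continuous_finsetSum _ fun i _ => continuous_finsetSum _ fun j _ => ?_
    exact Complex.continuous_normSq.comp (continuous_id.matrix_elem i j)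
  obtain ⟨Ω, hΩ, hmin⟩ := hK.exists_isMinOn hne hcont.continuousOn
  refine ⟨Ω, hΩ, fun T hT hnorm => ?_⟩
  have hmid : (1 / 2 : ℝ) • Ω + (1 / 2 : ℝ) • T Ω ∈ K :=
    hconv hΩ (hT hΩ) (by norm_num) (by norm_num) (by norm_num)
  have hle : hsNormSq Ω ≤ hsNormSq ((1 / 2 : ℝ) • Ω + (1 / 2 : ℝ) • T Ω) := hmin hmid
  -- the parallelogram identity
  have hpar : hsNormSq ((1 / 2 : ℝ) • Ω + (1 / 2 : ℝ) • T Ω) =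
      (hsNormSq Ω + hsNormSq (T Ω)) / 2 - hsNormSq (Ω - T Ω) / 4 := by
    simp only [hsNormSq, ← Finset.sum_add_distrib, Finset.sum_div, ← Finset.sum_sub_distrib]
    refine Finset.sum_congr rfl fun i _ => Finset.sum_congr rfl fun j _ => ?_
    simp only [Matrix.add_apply, Matrix.smul_apply, Matrix.sub_apply, Complex.normSq_apply,
      Complex.add_re, Complex.add_im, Complex.sub_re, Complex.sub_im, Complex.real_smul,
      Complex.mul_re, Complex.mul_im, Complex.ofReal_re, Complex.ofReal_im]
    ring
  rw [hpar, hnorm Ω] at hle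
  have hzero : hsNormSq (Ω - T Ω) ≤ 0 := by linarith
  ext i j
  have h1 : ∑ i, ∑ j, Complex.normSq ((Ω - T Ω) i j) = 0 :=
    le_antisymm hzero (Finset.sum_nonneg fun i _ => Finset.sum_nonneg fun j _ =>
      Complex.normSq_nonneg _)
  have h2 := (Finset.sum_eq_zero_iff_of_nonneg fun i _ => Finset.sum_nonneg fun j _ =>
    Complex.normSq_nonneg _).mp h1 i (Finset.mem_univ i)
  have h3 := (Finset.sum_eq_zero_iff_of_nonneg fun j _ => Complex.normSq_nonneg _).mp h2 j
    (Finset.mem_univ j)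
  rw [Complex.normSq_eq_zero, Matrix.sub_apply, sub_eq_zero] at h3
  exact h3.symm

/-! ### Pure product states -/

lemma IsState.exists_ketBra_decomposition {ι : Type*} [Fintype ι] {σ : Matrix ι ι ℂ}
    (hσ : IsState σ) : ∃ (w : ι → ℝ) (φ : ι → EuclideanSpace ℂ ι), (∀ k, 0 ≤ w k) ∧
      ∑ k, w k = 1 ∧ (∀ k, ‖φ k‖ = 1) ∧ σ = ∑ k, w k • ketBra (φ k) := by
  classical
  obtain ⟨hpos, htr⟩ := hσ
  refine ⟨hpos.1.eigenvalues, hpos.1.eigenvectorBasis, hpos.eigenvalues_nonneg, ?_,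
    hpos.1.eigenvectorBasis.norm_eq_one, ?_⟩
  · have h := hpos.1.trace_eq_sum_eigenvalues
    rw [htr] at h
    apply Complex.ofReal_injective
    rw [Complex.ofReal_sum, Complex.ofReal_one, h]
    rfl
  · ext i j
    conv_lhs => rw [hpos.1.spectral_theorem]
    simp only [Unitary.conjStarAlgAut_apply, Matrix.mul_apply, Matrix.sum_apply,
      Matrix.smul_apply, Matrix.diagonal_apply, mul_ite, mul_zero, Finset.sum_ite_eq',
      Finset.mem_univ, if_true, Matrix.IsHermitian.eigenvectorUnitary_apply, ketBra,
      Matrix.of_apply, Matrix.star_apply, Complex.real_smul, Function.comp_apply]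
    refine Finset.sum_congr rfl fun k _ => ?_
    change _ * (hpos.1.eigenvalues k : ℂ) * conj _ = _
    ring

lemma IsSeparable.mem_convexHull {α β : Type*} [Fintype α] [Fintype β]
    {ρ : Matrix (α × β) (α × β) ℂ} (hρ : IsSeparable ρ) :
    ρ ∈ convexHull ℝ {τ : Matrix (α × β) (α × β) ℂ | ∃ (φ : EuclideanSpace ℂ α)
      (χ : EuclideanSpace ℂ β), ‖φ‖ = 1 ∧ ‖χ‖ = 1 ∧ τ = ketBra φ ⊗ₖ ketBra χ} := by
  refine convexHull_min ?_ (convex_convexHull ℝ _) hρ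
  rintro _ ⟨σ, ω, hσ, hω, rfl⟩
  obtain ⟨w, φ, hw, hw1, hφ, rfl⟩ := hσ.exists_ketBra_decomposition
  obtain ⟨v, χ, hv, hv1, hχ, rfl⟩ := hω.exists_ketBra_decomposition
  have h : (∑ k, w k • ketBra (φ k)) ⊗ₖ (∑ l, v l • ketBra (χ l)) =
      ∑ k, w k • ∑ l, v l • (ketBra (φ k) ⊗ₖ ketBra (χ l)) := by
    ext x z
    simp only [Matrix.kroneckerMap_apply, Matrix.sum_apply, Matrix.smul_apply,
      Finset.sum_mul_sum, Finset.smul_sum]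
    refine Finset.sum_congr rfl fun k _ => Finset.sum_congr rfl fun l _ => ?_
    simp only [Complex.real_smul]
    ring
  rw [h]
  refine (convex_convexHull ℝ _).sum_mem (fun k _ => hw k) hw1 fun k _ =>
    (convex_convexHull ℝ _).sum_mem (fun l _ => hv l) hv1 fun l _ =>
      subset_convexHull ℝ _ ⟨φ k, χ l, hφ k, hχ l, rfl⟩

/-- The objective of the second problem as a real-linear functional. -/
def flipFunctional (n d : ℕ) : Matrix ((Word n d × Word n d) × (Word n d × Word n d))
    ((Word n d × Word n d) × (Word n d × Word n d)) ℂ →ₗ[ℝ] ℝ where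
  toFun := flipValue
  map_add' Ω Ω' := by
    have : reduceAA (Ω + Ω') = reduceAA Ω + reduceAA Ω' := by
      ext r c
      simp only [reduceAA, Matrix.of_apply, Matrix.add_apply, Finset.sum_add_distrib]
    rw [flipValue, this, Matrix.add_mul, Matrix.trace_add, Complex.add_re]
    rfl
  map_smul' t Ω := by
    have : reduceAA (t • Ω) = t • reduceAA Ω := by
      ext r c
      simp only [reduceAA, Matrix.of_apply, Matrix.smul_apply, Finset.smul_sum]
    rw [flipValue, this, Matrix.smul_mul, Matrix.trace_smul, Complex.smul_re]
    rfl

/-- Antisymmetry of the row labels in all pairs `A_i B_i` and `A'_i B'_i`. -/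
def HasAntisymmRows {n d : ℕ} {κ : Type*}
    (Ω : Matrix ((Word n d × Word n d) × (Word n d × Word n d)) κ ℂ) : Prop :=
  (∀ i x y z, Ω (swapAt i x, y) z = -Ω (x, y) z) ∧ ∀ i x y z, Ω (x, swapAt i y) z = -Ω (x, y) z

lemma hasAntisymmRows_rhoProd {n d : ℕ} (hd : 2 ≤ d) (y : Fin n → Shape) :
    HasAntisymmRows (rhoProd d y) := by
  refine ⟨fun i x x' z => ?_, fun i x x' z => ?_⟩
  · simp only [rhoProd, Matrix.of_apply]
    rw [← Finset.mul_prod_erase _ _ (Finset.mem_univ i),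
      ← Finset.mul_prod_erase _ (fun j => rho d (y j) (quadAt (x, x') j) (quadAt z j))
        (Finset.mem_univ i), ← neg_mul]
    congr 1
    · simp only [quadAt, pairAt_swapAt_self]
      exact (rho_col hd (y i) _).1 (x.1 i) (x.2 i) _
    · refine Finset.prod_congr rfl fun j hj => ?_
      simp only [quadAt, pairAt_swapAt_of_ne (Finset.ne_of_mem_erase hj)]
  · simp only [rhoProd, Matrix.of_apply]
    rw [← Finset.mul_prod_erase _ _ (Finset.mem_univ i),
      ← Finset.mul_prod_erase _ (fun j => rho d (y j) (quadAt (x, x') j) (quadAt z j))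
        (Finset.mem_univ i), ← neg_mul]
    congr 1
    · simp only [quadAt, pairAt_swapAt_self]
      exact (rho_col hd (y i) _).2 _ (x'.1 i) (x'.2 i)
    · refine Finset.prod_congr rfl fun j hj => ?_
      simp only [quadAt, pairAt_swapAt_of_ne (Finset.ne_of_mem_erase hj)]

lemma IsFeasible.hasAntisymmRows {n d : ℕ} (hd : 2 ≤ d)
    {Ω : Matrix ((Word n d × Word n d) × (Word n d × Word n d))
      ((Word n d × Word n d) × (Word n d × Word n d)) ℂ} (hΩ : IsFeasible Ω) :
    HasAntisymmRows Ω := by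
  obtain ⟨p, -, -, rfl⟩ := hΩ.mixture
  refine ⟨fun i x y z => ?_, fun i x y z => ?_⟩
  · simp only [Matrix.sum_apply, Matrix.smul_apply, smul_eq_mul, ← Finset.sum_neg_distrib]
    exact Finset.sum_congr rfl fun s _ => by
      rw [(hasAntisymmRows_rhoProd hd s).1, mul_neg]
  · simp only [Matrix.sum_apply, Matrix.smul_apply, smul_eq_mul, ← Finset.sum_neg_distrib]
    exact Finset.sum_congr rfl fun s _ => by
      rw [(hasAntisymmRows_rhoProd hd s).2, mul_neg]

lemma exists_ne_zero_of_norm_eq_one {ι : Type*} [Fintype ι] {ψ : EuclideanSpace ℂ ι}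
    (h : ‖ψ‖ = 1) : ∃ x, ψ x ≠ 0 := by
  by_contra! h0
  have : ψ = 0 := PiLp.ext h0
  rw [this, norm_zero] at h
  exact zero_ne_one h

/-- A feasible state is a mixture of products of pure states. Its rows are antisymmetric in each
pair, so the vectors in the mixture lie in `(∧²)^{⊗n}`, and the value of each product is at most the
mean of the two purities. -/
theorem IsFeasible.flipValue_le {n d : ℕ} (hd : 2 ≤ d) {M : ℝ}
    (hM : ∀ ψ ∈ wedgePow n d, ‖ψ‖ = 1 → purity ψ ≤ M)
    {Ω : Matrix ((Word n d × Word n d) × (Word n d × Word n d))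
      ((Word n d × Word n d) × (Word n d × Word n d)) ℂ} (hΩ : IsFeasible Ω) :
    flipValue Ω ≤ M := by
  have hrows := hΩ.hasAntisymmRows hd
  obtain ⟨κ, _, w, τ, hw, hw1, hτ, hsum⟩ :=
    mem_convexHull_iff_exists_fintype.mp hΩ.separable.mem_convexHull
  choose φ χ hφ hχ hτ using hτ
  have hentry : ∀ x y x' y', Ω (x, y) (x', y') =
      ∑ k, w k * ((φ k x * conj (φ k x')) * (χ k y * conj (χ k y'))) := by
    intro x y x' y'
    rw [← hsum, Matrix.sum_apply]
    refine Finset.sum_congr rfl fun k _ => ?_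
    rw [Matrix.smul_apply, hτ, Complex.real_smul]
    rfl
  -- if a positive combination of the projectors onto `φ k ⊗ χ k` is annihilated by a functional,
  -- then so is every vector of nonzero weight
  have hvanish : ∀ (a : κ → ℂ), ∑ k, (w k : ℂ) * (a k * conj (a k)) = 0 → ∀ k, w k ≠ 0 →
      a k = 0 := by
    intro a ha k hk
    have h1 : ∑ k, w k * Complex.normSq (a k) = 0 := by
      have : ((∑ k, w k * Complex.normSq (a k) : ℝ) : ℂ) = 0 := by
        rw [← ha, Complex.ofReal_sum]
        exact Finset.sum_congr rfl fun k _ => by rw [Complex.ofReal_mul, Complex.mul_conj]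
      exact_mod_cast this
    have h2 := (Finset.sum_eq_zero_iff_of_nonneg fun k _ =>
      mul_nonneg (hw k) (Complex.normSq_nonneg _)).mp h1 k (Finset.mem_univ k)
    exact Complex.normSq_eq_zero.mp ((mul_eq_zero.mp h2).resolve_left hk)
  have hφmem : ∀ k, w k ≠ 0 → φ k ∈ wedgePow n d := by
    intro k hk
    rw [mem_wedgePow]
    intro i x
    obtain ⟨y, hy⟩ := exists_ne_zero_of_norm_eq_one (hχ k)
    have h0 := hvanish (fun k => (φ k (swapAt i x) + φ k x) * χ k y) (by
      have e1 := hrows.1 i x y (x, y)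
      have e2 := hrows.1 i x y (swapAt i x, y)
      rw [hentry, hentry, eq_neg_iff_add_eq_zero, ← Finset.sum_add_distrib] at e1 e2
      have e3 := congrArg₂ (· + ·) e1 e2
      simp only [← Finset.sum_add_distrib, add_zero] at e3
      rw [← e3]
      refine Finset.sum_congr rfl fun k _ => ?_
      simp only [map_mul, map_add]
      ring) k hk
    exact eq_neg_of_add_eq_zero_left ((mul_eq_zero.mp h0).resolve_right hy)
  have hχmem : ∀ k, w k ≠ 0 → χ k ∈ wedgePow n d := by
    intro k hk
    rw [mem_wedgePow]
    intro i y
    obtain ⟨x, hx⟩ := exists_ne_zero_of_norm_eq_one (hφ k)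
    have h0 := hvanish (fun k => φ k x * (χ k (swapAt i y) + χ k y)) (by
      have e1 := hrows.2 i x y (x, y)
      have e2 := hrows.2 i x y (x, swapAt i y)
      rw [hentry, hentry, eq_neg_iff_add_eq_zero, ← Finset.sum_add_distrib] at e1 e2
      have e3 := congrArg₂ (· + ·) e1 e2
      simp only [← Finset.sum_add_distrib, add_zero] at e3
      rw [← e3]
      refine Finset.sum_congr rfl fun k _ => ?_
      simp only [map_mul, map_add]
      ring) k hk
    exact eq_neg_of_add_eq_zero_left ((mul_eq_zero.mp h0).resolve_left hx)
  calc flipValue Ω = flipFunctional n d Ω := rfl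
    _ = ∑ k, w k * flipValue (τ k) := by
      rw [← hsum, map_sum]
      exact Finset.sum_congr rfl fun k _ => by rw [map_smul, smul_eq_mul]; rfl
    _ ≤ ∑ k, w k * M := by
      refine Finset.sum_le_sum fun k _ => ?_
      by_cases hk : w k = 0
      · rw [hk, zero_mul, zero_mul]
      · refine mul_le_mul_of_nonneg_left ?_ (hw k)
        rw [hτ]
        have h1 := flipValue_ketBra_le (φ k) (χ k)
        have h2 := hM _ (hφmem k hk) (hφ k)
        have h3 := hM _ (hχmem k hk) (hχ k)
        linarith
    _ = M := by rw [← Finset.sum_mul, hw1, one_mul]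

/-! ### The convex hull of product states and its symmetries -/

/-- The products of two unit vectors of `(∧²)^{⊗n}` at which the objective takes the value `t`. -/
def pureProducts (n d : ℕ) (t : ℝ) : Set (Matrix ((Word n d × Word n d) × (Word n d × Word n d))
    ((Word n d × Word n d) × (Word n d × Word n d)) ℂ) :=
  {τ | (∃ φ ∈ wedgePow n d, ∃ χ ∈ wedgePow n d, ‖φ‖ = 1 ∧ ‖χ‖ = 1 ∧
    τ = ketBra φ ⊗ₖ ketBra χ) ∧ flipValue τ = t}

lemma isCompact_unit_wedgePow (n d : ℕ) :
    IsCompact {ψ : EuclideanSpace ℂ (Word n d × Word n d) | ψ ∈ wedgePow n d ∧ ‖ψ‖ = 1} := by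
  have h := (isCompact_sphere (0 : EuclideanSpace ℂ (Word n d × Word n d)) 1).inter_left
    (Submodule.closed_of_finiteDimensional (wedgePow n d))
  have hset : {ψ : EuclideanSpace ℂ (Word n d × Word n d) | ψ ∈ wedgePow n d ∧ ‖ψ‖ = 1} =
      (wedgePow n d : Set (EuclideanSpace ℂ (Word n d × Word n d))) ∩ Metric.sphere 0 1 :=
    Set.ext fun _ => and_congr Iff.rfl mem_sphere_zero_iff_norm.symm
  rw [hset]
  exact h

lemma isCompact_pureProducts (n d : ℕ) (t : ℝ) : IsCompact (pureProducts n d t) := by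
  have hcont : Continuous fun p : EuclideanSpace ℂ (Word n d × Word n d) ×
      EuclideanSpace ℂ (Word n d × Word n d) => ketBra p.1 ⊗ₖ ketBra p.2 := by
    refine continuous_matrix fun x z => ?_
    simp only [Matrix.kroneckerMap_apply, ketBra, Matrix.of_apply]
    fun_prop
  have hflip : Continuous (flipFunctional n d) := LinearMap.continuous_of_finiteDimensional _
  have h := (((isCompact_unit_wedgePow n d).prod (isCompact_unit_wedgePow n d)).image
    hcont).inter_right (isClosed_singleton.preimage hflip : IsClosed (flipFunctional n d ⁻¹' {t}))
  convert h using 1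
  ext τ
  constructor
  · rintro ⟨⟨φ, hφ, χ, hχ, hφ1, hχ1, rfl⟩, ht⟩
    exact ⟨⟨(φ, χ), ⟨⟨hφ, hφ1⟩, ⟨hχ, hχ1⟩⟩, rfl⟩, ht⟩
  · rintro ⟨⟨⟨φ, χ⟩, ⟨⟨hφ, hφ1⟩, ⟨hχ, hχ1⟩⟩, rfl⟩, ht⟩
    exact ⟨⟨φ, hφ, χ, hχ, hφ1, hχ1, rfl⟩, ht⟩

lemma isState_kronecker {α β : Type*} [Fintype α] [Fintype β] {σ : Matrix α α ℂ}
    {ω : Matrix β β ℂ} (hσ : IsState σ) (hω : IsState ω) : IsState (σ ⊗ₖ ω) :=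
  ⟨hσ.1.kronecker hω.1, by rw [Matrix.trace_kronecker, hσ.2, hω.2, one_mul]⟩

lemma convex_isState (ι : Type*) [Fintype ι] :
    Convex ℝ {ρ : Matrix ι ι ℂ | IsState ρ} := by
  intro ρ hρ σ hσ a b ha hb hab
  refine ⟨(hρ.1.smul ha).add (hσ.1.smul hb), ?_⟩
  rw [Matrix.trace_add, Matrix.trace_smul, Matrix.trace_smul, hρ.2, hσ.2, ← add_smul, hab,
    one_smul]

lemma isState_of_mem_convexHull {n d : ℕ} {t : ℝ}
    {Ω : Matrix ((Word n d × Word n d) × (Word n d × Word n d))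
      ((Word n d × Word n d) × (Word n d × Word n d)) ℂ}
    (hΩ : Ω ∈ convexHull ℝ (pureProducts n d t)) : IsState Ω := by
  refine convexHull_min ?_ (convex_isState _) hΩ
  rintro _ ⟨⟨φ, -, χ, -, hφ1, hχ1, rfl⟩, -⟩
  exact isState_kronecker (isState_ketBra hφ1) (isState_ketBra hχ1)

lemma isSeparable_of_mem_convexHull {n d : ℕ} {t : ℝ}
    {Ω : Matrix ((Word n d × Word n d) × (Word n d × Word n d))
      ((Word n d × Word n d) × (Word n d × Word n d)) ℂ}
    (hΩ : Ω ∈ convexHull ℝ (pureProducts n d t)) : IsSeparable Ω := by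
  refine convexHull_mono ?_ hΩ
  rintro _ ⟨⟨φ, -, χ, -, hφ1, hχ1, rfl⟩, -⟩
  exact ⟨_, _, isState_ketBra hφ1, isState_ketBra hχ1, rfl⟩

lemma flipValue_of_mem_convexHull {n d : ℕ} {t : ℝ}
    {Ω : Matrix ((Word n d × Word n d) × (Word n d × Word n d))
      ((Word n d × Word n d) × (Word n d × Word n d)) ℂ}
    (hΩ : Ω ∈ convexHull ℝ (pureProducts n d t)) : flipValue Ω = t :=
  convexHull_min (fun _ hτ => hτ.2)
    ((convex_singleton t).linear_preimage (flipFunctional n d)) hΩ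

lemma hasAntisymmRows_of_mem_convexHull {n d : ℕ} {t : ℝ}
    {Ω : Matrix ((Word n d × Word n d) × (Word n d × Word n d))
      ((Word n d × Word n d) × (Word n d × Word n d)) ℂ}
    (hΩ : Ω ∈ convexHull ℝ (pureProducts n d t)) : HasAntisymmRows Ω := by
  refine convexHull_min (t := {Ω | HasAntisymmRows Ω}) ?_ ?_ hΩ
  · rintro _ ⟨⟨φ, hφ, χ, hχ, -, -, rfl⟩, -⟩
    rw [mem_wedgePow] at hφ hχ
    refine ⟨fun i x y z => ?_, fun i x y z => ?_⟩
    · simp only [Matrix.kroneckerMap_apply, ketBra, Matrix.of_apply, hφ i x]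
      ring
    · simp only [Matrix.kroneckerMap_apply, ketBra, Matrix.of_apply, hχ i y]
      ring
  · intro A hA B hB a b _ _ _
    refine ⟨fun i x y z => ?_, fun i x y z => ?_⟩
    · simp only [Matrix.add_apply, Matrix.smul_apply, hA.1 i x y z, hB.1 i x y z, smul_neg,
        neg_add]
    · simp only [Matrix.add_apply, Matrix.smul_apply, hA.2 i x y z, hB.2 i x y z, smul_neg,
        neg_add]

/-- Conjugation `X ↦ U X Uᴴ` as a real-linear map. -/
def conjugation {ι : Type*} [Fintype ι] (U : Matrix ι ι ℂ) :
    Matrix ι ι ℂ →ₗ[ℝ] Matrix ι ι ℂ where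
  toFun X := U * X * U.conjTranspose
  map_add' X Y := by rw [Matrix.mul_add, Matrix.add_mul]
  map_smul' t X := by rw [Matrix.mul_smul, Matrix.smul_mul, RingHom.id_apply]

lemma hsNormSq_conjugation {ι : Type*} [Fintype ι] [DecidableEq ι] {U : Matrix ι ι ℂ}
    (hU : U.conjTranspose * U = 1) (X : Matrix ι ι ℂ) :
    hsNormSq (conjugation U X) = hsNormSq X := by
  apply Complex.ofReal_injective
  rw [hsNormSq_eq_trace, hsNormSq_eq_trace]
  simp only [conjugation, LinearMap.coe_mk, AddHom.coe_mk, Matrix.conjTranspose_mul,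
    Matrix.conjTranspose_conjTranspose]
  calc (U * (X.conjTranspose * U.conjTranspose) * (U * X * U.conjTranspose)).trace
      = (U * (X.conjTranspose * (U.conjTranspose * U) * X) * U.conjTranspose).trace := by
        simp only [Matrix.mul_assoc]
    _ = (X.conjTranspose * X).trace := by
        rw [hU, Matrix.mul_one, Matrix.trace_mul_comm, ← Matrix.mul_assoc, hU, Matrix.one_mul]

lemma kronecker_isometry {α β : Type*} [Fintype α] [Fintype β] [DecidableEq α] [DecidableEq β]
    {A : Matrix α α ℂ} {B : Matrix β β ℂ} (hA : A.conjTranspose * A = 1)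
    (hB : B.conjTranspose * B = 1) : (A ⊗ₖ B).conjTranspose * (A ⊗ₖ B) = 1 := by
  rw [Matrix.conjTranspose_kronecker, ← Matrix.mul_kronecker_mul, hA, hB, Matrix.one_kronecker_one]

lemma prodMatrix_isometry {ι : Type*} [Fintype ι] [DecidableEq ι] {n : ℕ}
    {g : Fin n → Matrix ι ι ℂ} (hg : ∀ i, (g i).conjTranspose * g i = 1) :
    (prodMatrix g).conjTranspose * prodMatrix g = 1 := by
  rw [prodMatrix_conjTranspose, prodMatrix_mul]
  simp only [hg, prodMatrix_one]

/-- The operator `g_1^{⊗4} ⊗ ⋯ ⊗ g_n^{⊗4}`. -/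
abbrev localFour {n d : ℕ} (g : Fin n → Matrix (Fin d) (Fin d) ℂ) :
    Matrix ((Word n d × Word n d) × (Word n d × Word n d))
      ((Word n d × Word n d) × (Word n d × Word n d)) ℂ :=
  (prodMatrix g ⊗ₖ prodMatrix g) ⊗ₖ (prodMatrix g ⊗ₖ prodMatrix g)

lemma mapsTo_conjugation_localFour {n d : ℕ} {g : Fin n → Matrix (Fin d) (Fin d) ℂ}
    (hg : ∀ i, (g i).conjTranspose * g i = 1) (t : ℝ) :
    Set.MapsTo (conjugation (localFour g)) (convexHull ℝ (pureProducts n d t))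
      (convexHull ℝ (pureProducts n d t)) := by
  have hW := prodMatrix_isometry hg
  refine convexHull_min ?_ ((convex_convexHull ℝ _).linear_preimage (conjugation (localFour g)))
  rintro _ ⟨⟨φ, hφ, χ, hχ, hφ1, hχ1, rfl⟩, ht⟩
  apply subset_convexHull
  have h : conjugation (localFour g) (ketBra φ ⊗ₖ ketBra χ) =
      ketBra (actOn (prodMatrix g ⊗ₖ prodMatrix g) φ) ⊗ₖ
        ketBra (actOn (prodMatrix g ⊗ₖ prodMatrix g) χ) := by
    simp only [conjugation, LinearMap.coe_mk, AddHom.coe_mk, ketBra_actOn, localFour]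
    rw [Matrix.conjTranspose_kronecker (prodMatrix g ⊗ₖ prodMatrix g), ← Matrix.mul_kronecker_mul,
      ← Matrix.mul_kronecker_mul]
  refine ⟨⟨_, actOn_mem_wedgePow g hφ, _, actOn_mem_wedgePow g hχ,
    norm_actOn (kronecker_isometry hW hW) hφ1, norm_actOn (kronecker_isometry hW hW) hχ1, h⟩, ?_⟩
  rw [h, flipValue_actOn hW, ht]

/-- The permutation of the sites, as an equivalence of labels. -/
def wordPerm {n : ℕ} (d : ℕ) (π : Equiv.Perm (Fin n)) : Word n d ≃ Word n d where
  toFun a := a ∘ π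
  invFun a := a ∘ π.symm
  left_inv a := by ext; simp
  right_inv a := by ext; simp

/-- The vector with the sites permuted by `π`. -/
def permVec {n d : ℕ} (π : Equiv.Perm (Fin n)) (ψ : EuclideanSpace ℂ (Word n d × Word n d)) :
    EuclideanSpace ℂ (Word n d × Word n d) :=
  WithLp.toLp 2 fun x => ψ (wordPerm d π x.1, wordPerm d π x.2)

lemma permVec_mem_wedgePow {n d : ℕ} (π : Equiv.Perm (Fin n))
    {ψ : EuclideanSpace ℂ (Word n d × Word n d)} (hψ : ψ ∈ wedgePow n d) :
    permVec π ψ ∈ wedgePow n d := by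
  rw [mem_wedgePow] at hψ ⊢
  intro i x
  have h : (wordPerm d π (swapAt i x).1, wordPerm d π (swapAt i x).2) =
      swapAt (π.symm i) (wordPerm d π x.1, wordPerm d π x.2) := by
    apply Prod.ext <;>
    · funext j
      by_cases hj : π j = i
      · subst hj
        simp [wordPerm, swapAt]
      · have : j ≠ π.symm i := fun h => hj (by rw [h, Equiv.apply_symm_apply])
        simp [wordPerm, swapAt, hj, this]
  simp only [permVec]
  rw [h]
  exact hψ _ _

lemma norm_permVec {n d : ℕ} (π : Equiv.Perm (Fin n))
    (ψ : EuclideanSpace ℂ (Word n d × Word n d)) : ‖permVec π ψ‖ = ‖ψ‖ := by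
  rw [EuclideanSpace.norm_eq, EuclideanSpace.norm_eq]
  congr 1
  exact Equiv.sum_comp ((wordPerm d π).prodCongr (wordPerm d π)) fun x => ‖ψ x‖ ^ 2

lemma traceSecond_ketBra_permVec {n d : ℕ} (π : Equiv.Perm (Fin n))
    (ψ : EuclideanSpace ℂ (Word n d × Word n d)) : traceSecond (ketBra (permVec π ψ)) =
      (traceSecond (ketBra ψ)).submatrix (wordPerm d π) (wordPerm d π) := by
  ext a c
  exact Equiv.sum_comp (wordPerm d π) fun b =>
    ψ (wordPerm d π a, b) * conj (ψ (wordPerm d π c, b))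

lemma permute_bijective {n d : ℕ} (π : Equiv.Perm (Fin n)) :
    Function.Bijective (permute π : (Word n d × Word n d) × (Word n d × Word n d) → _) :=
  (((wordPerm d π).prodCongr (wordPerm d π)).prodCongr
    ((wordPerm d π).prodCongr (wordPerm d π))).bijective

/-- The permutation of the sites, acting on matrices. -/
def permConjugation {n : ℕ} (d : ℕ) (π : Equiv.Perm (Fin n)) :
    Matrix ((Word n d × Word n d) × (Word n d × Word n d))
      ((Word n d × Word n d) × (Word n d × Word n d)) ℂ →ₗ[ℝ]
    Matrix ((Word n d × Word n d) × (Word n d × Word n d))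
      ((Word n d × Word n d) × (Word n d × Word n d)) ℂ where
  toFun X := X.submatrix (permute π) (permute π)
  map_add' _ _ := rfl
  map_smul' _ _ := rfl

lemma hsNormSq_permConjugation {n d : ℕ} (π : Equiv.Perm (Fin n))
    (X : Matrix ((Word n d × Word n d) × (Word n d × Word n d))
      ((Word n d × Word n d) × (Word n d × Word n d)) ℂ) :
    hsNormSq (permConjugation d π X) = hsNormSq X := by
  unfold hsNormSq
  exact (Finset.sum_congr rfl fun i _ =>
    (permute_bijective π).sum_comp fun j => Complex.normSq (X (permute π i) j)).trans
    ((permute_bijective π).sum_comp fun i => ∑ j, Complex.normSq (X i j))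

lemma mapsTo_permConjugation {n d : ℕ} (π : Equiv.Perm (Fin n)) (t : ℝ) :
    Set.MapsTo (permConjugation d π) (convexHull ℝ (pureProducts n d t))
      (convexHull ℝ (pureProducts n d t)) := by
  refine convexHull_min ?_ ((convex_convexHull ℝ _).linear_preimage (permConjugation d π))
  rintro _ ⟨⟨φ, hφ, χ, hχ, hφ1, hχ1, rfl⟩, ht⟩
  apply subset_convexHull
  have h : permConjugation d π (ketBra φ ⊗ₖ ketBra χ) =
      ketBra (permVec π φ) ⊗ₖ ketBra (permVec π χ) := rfl
  refine ⟨⟨_, permVec_mem_wedgePow π hφ, _, permVec_mem_wedgePow π hχ,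
    (norm_permVec π φ).trans hφ1, (norm_permVec π χ).trans hχ1, h⟩, ?_⟩
  rw [← ht, h, flipValue_kronecker, flipValue_kronecker, traceSecond_ketBra_permVec,
    traceSecond_ketBra_permVec, Matrix.submatrix_mul_equiv]
  congr 1
  exact Equiv.sum_comp (wordPerm d π) fun a =>
    (traceSecond (ketBra φ) * traceSecond (ketBra χ)) a a

/-! ### The symmetrised state -/

lemma quadEquiv_symm_apply {n d : ℕ} (f : Fin n → Quad d) : (quadEquiv n d).symm f =
    ((fun i => (f i).1.1, fun i => (f i).1.2), (fun i => (f i).2.1, fun i => (f i).2.2)) := rfl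

lemma quadEquiv_symm_update_left {n d : ℕ} (x : Fin n → Quad d) (i : Fin n) (a b : Fin d)
    (y : Pair d) : (quadEquiv n d).symm (Function.update x i ((b, a), y)) =
      (swapAt i ((quadEquiv n d).symm (Function.update x i ((a, b), y))).1,
        ((quadEquiv n d).symm (Function.update x i ((a, b), y))).2) := by
  rw [quadEquiv_symm_apply, quadEquiv_symm_apply]
  refine Prod.ext (Prod.ext ?_ ?_) (Prod.ext ?_ ?_) <;>
  · funext j
    by_cases hj : j = i
    · subst hj
      simp [swapAt]
    · simp [swapAt, hj]

lemma quadEquiv_symm_update_right {n d : ℕ} (x : Fin n → Quad d) (i : Fin n) (a b : Fin d)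
    (y : Pair d) : (quadEquiv n d).symm (Function.update x i (y, (b, a))) =
      (((quadEquiv n d).symm (Function.update x i (y, (a, b)))).1,
        swapAt i ((quadEquiv n d).symm (Function.update x i (y, (a, b)))).2) := by
  rw [quadEquiv_symm_apply, quadEquiv_symm_apply]
  refine Prod.ext (Prod.ext ?_ ?_) (Prod.ext ?_ ?_) <;>
  · funext j
    by_cases hj : j = i
    · subst hj
      simp [swapAt]
    · simp [swapAt, hj]

lemma localFour_submatrix {n d : ℕ} (i : Fin n) (g : Matrix (Fin d) (Fin d) ℂ) :
    (localFour (Function.update (fun _ => 1) i g)).submatrix (quadEquiv n d).symm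
      (quadEquiv n d).symm = atSite i (fourFold g) := by
  ext x z
  simp only [Matrix.submatrix_apply, localFour, Matrix.kroneckerMap_apply, prodMatrix_apply,
    ← Finset.prod_mul_distrib, atSite]
  refine Finset.prod_congr rfl fun j _ => ?_
  by_cases hj : j = i
  · subst hj
    simp only [Function.update_self]
    rfl
  · simp only [Function.update_of_ne hj]
    have h1 : fourFold (1 : Matrix (Fin d) (Fin d) ℂ) = 1 := by
      simp only [fourFold, Matrix.one_kronecker_one]
    rw [← h1]
    rfl

lemma isSiteInvariant_siteSlice {n d : ℕ}
    {Ω : Matrix ((Word n d × Word n d) × (Word n d × Word n d))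
      ((Word n d × Word n d) × (Word n d × Word n d)) ℂ} (hΩ : Ω.IsHermitian)
    (hrows : HasAntisymmRows Ω)
    (hcomm : ∀ i, ∀ g ∈ Matrix.unitaryGroup (Fin d) ℂ,
      Ω * localFour (Function.update (fun _ : Fin n => 1) i g) =
        localFour (Function.update (fun _ => 1) i g) * Ω) (i : Fin n) (x z : Fin n → Quad d) :
    IsSiteInvariant (siteSlice (Ω.submatrix (quadEquiv n d).symm (quadEquiv n d).symm) i x z) := by
  have hcol : ∀ (x z : Fin n → Quad d) (c : Quad d), IsBiAntisymm fun a =>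
      siteSlice (Ω.submatrix (quadEquiv n d).symm (quadEquiv n d).symm) i x z a c := by
    intro x z c
    refine ⟨fun a b y => ?_, fun y a b => ?_⟩
    · simp only [siteSlice, Matrix.of_apply, Matrix.submatrix_apply]
      rw [quadEquiv_symm_update_left x]
      exact hrows.1 i _ _ _
    · simp only [siteSlice, Matrix.of_apply, Matrix.submatrix_apply]
      rw [quadEquiv_symm_update_right x]
      exact hrows.2 i _ _ _
  refine ⟨hcol x z, fun c => ?_, fun g hg => siteSlice_comm ?_ x z⟩
  · have h : ∀ a, siteSlice (Ω.submatrix (quadEquiv n d).symm (quadEquiv n d).symm) i x z c a =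
        conj (siteSlice (Ω.submatrix (quadEquiv n d).symm (quadEquiv n d).symm) i z x a c) :=
      fun a => (hΩ.apply _ _).symm
    refine ⟨fun a b y => ?_, fun y a b => ?_⟩
    · simp only [h]
      exact (congrArg conj ((hcol z x c).1 a b y)).trans (map_neg _ _)
    · simp only [h]
      exact (congrArg conj ((hcol z x c).2 y a b)).trans (map_neg _ _)
  · rw [← localFour_submatrix, Matrix.submatrix_mul_equiv, Matrix.submatrix_mul_equiv,
      hcomm i g hg]

/-- Every value of the purity is attained by a feasible state. The convex hull of the product states
with this value of the objective is compact and invariant under local unitaries and permutations of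
the sites; its point of least norm is invariant, and hence a mixture of projectors. -/
theorem exists_isFeasible {n d : ℕ} (hd : 2 ≤ d) {ψ : EuclideanSpace ℂ (Word n d × Word n d)}
    (hψ : ψ ∈ wedgePow n d) (h1 : ‖ψ‖ = 1) :
    ∃ Ω : Matrix ((Word n d × Word n d) × (Word n d × Word n d))
      ((Word n d × Word n d) × (Word n d × Word n d)) ℂ,
      IsFeasible Ω ∧ flipValue Ω = purity ψ := by
  obtain ⟨Ω, hΩ, hfix⟩ := exists_fixed_point
    (isCompact_convexHull_of_finiteDimensional (isCompact_pureProducts n d (purity ψ)))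
    (convex_convexHull ℝ _)
    ⟨_, subset_convexHull ℝ _ ⟨⟨ψ, hψ, ψ, hψ, h1, h1, rfl⟩, flipValue_ketBra ψ⟩⟩
  have hstate := isState_of_mem_convexHull hΩ
  have hcomm : ∀ i, ∀ g ∈ Matrix.unitaryGroup (Fin d) ℂ,
      Ω * localFour (Function.update (fun _ : Fin n => 1) i g) =
        localFour (Function.update (fun _ => 1) i g) * Ω := by
    intro i g hg
    have hiso : ∀ j, (Function.update (fun _ : Fin n => (1 : Matrix (Fin d) (Fin d) ℂ)) i g
        j).conjTranspose * Function.update (fun _ : Fin n => (1 : Matrix (Fin d) (Fin d) ℂ)) i g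
        j = 1 := by
      intro j
      by_cases hj : j = i
      · subst hj
        rw [Function.update_self]
        exact Matrix.mem_unitaryGroup_iff'.mp hg
      · rw [Function.update_of_ne hj, Matrix.conjTranspose_one, Matrix.one_mul]
    have hW := prodMatrix_isometry hiso
    have hU := kronecker_isometry (kronecker_isometry hW hW) (kronecker_isometry hW hW)
    have h := hfix _ (mapsTo_conjugation_localFour hiso _) (hsNormSq_conjugation hU)
    conv_lhs => rw [← h]
    simp only [conjugation, LinearMap.coe_mk, AddHom.coe_mk]
    rw [Matrix.mul_assoc, hU, Matrix.mul_one]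
  have hstate' : IsState (Ω.submatrix (quadEquiv n d).symm (quadEquiv n d).symm) :=
    ⟨hstate.1.submatrix _,
      (Equiv.sum_comp (quadEquiv n d).symm fun x => Ω x x).trans hstate.2⟩
  obtain ⟨p, hp, hp1, hmix⟩ := exists_mixture hd hstate' (isSiteInvariant_siteSlice hstate.1.1
    (hasAntisymmRows_of_mem_convexHull hΩ) hcomm)
  refine ⟨Ω, ⟨hstate, ⟨p, hp, hp1, ?_⟩, isSeparable_of_mem_convexHull hΩ, fun π =>
    hfix _ (mapsTo_permConjugation π _) (hsNormSq_permConjugation π)⟩,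
    flipValue_of_mem_convexHull hΩ⟩
  ext x z
  have h := congrFun (congrFun hmix (quadEquiv n d x)) (quadEquiv n d z)
  simp only [Matrix.submatrix_apply, Equiv.symm_apply_apply] at h
  rw [h, Matrix.sum_apply, Matrix.sum_apply]
  rfl

/-! ### Existence of the maximum -/

lemma continuous_purity (n d : ℕ) :
    Continuous (purity : EuclideanSpace ℂ (Word n d × Word n d) → ℝ) := by
  unfold purity
  refine Complex.continuous_re.comp (Continuous.matrix_trace (Continuous.pow ?_ 2))
  refine continuous_matrix fun a c => ?_
  simp only [traceSecond, ketBra, Matrix.of_apply]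
  fun_prop

/-- The normalised power of a singlet is a unit vector of `(∧²)^{⊗n}`. -/
lemma exists_unit_mem_wedgePow (n : ℕ) {d : ℕ} (hd : 2 ≤ d) :
    ∃ ψ ∈ wedgePow n d, ‖ψ‖ = 1 := by
  let n₀ : Fin d := ⟨0, by omega⟩
  let n₁ : Fin d := ⟨1, by omega⟩
  have h01 : n₀ ≠ n₁ := by simp [n₀, n₁]
  let v : EuclideanSpace ℂ (Pair d) := WithLp.toLp 2 fun x =>
    stdVec n₀ x.1 * stdVec n₁ x.2 - stdVec n₁ x.1 * stdVec n₀ x.2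
  let ψ : EuclideanSpace ℂ (Word n d × Word n d) := WithLp.toLp 2 fun x => ∏ i, v (pairAt x i)
  have hmem : ψ ∈ wedgePow n d := by
    refine Submodule.subset_span ⟨fun _ => v, fun _ a b => ?_, fun x => rfl⟩
    simp only [v]
    ring
  have hne : ψ ≠ 0 := by
    intro h
    have h0 : ψ (fun _ => n₀, fun _ => n₁) = 0 := by rw [h, PiLp.zero_apply]
    simp [ψ, v, pairAt, stdVec, h01] at h0
  refine ⟨(‖ψ‖⁻¹ : ℂ) • ψ, Submodule.smul_mem _ _ hmem, ?_⟩
  rw [norm_smul, norm_inv, Complex.norm_real, norm_norm, inv_mul_cancel₀ (norm_ne_zero_iff.mpr hne)]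

end AntisymPurity

end

theorem lemma3 (n d : ℕ) (hd : 2 ≤ d) :
    ∃ M : ℝ,
      IsGreatest {t : ℝ | ∃ ψ : EuclideanSpace ℂ
          (AntisymPurity.Word n d × AntisymPurity.Word n d),
        ψ ∈ AntisymPurity.wedgePow n d ∧ ‖ψ‖ = 1 ∧ t = AntisymPurity.purity ψ} M ∧
      IsGreatest {t : ℝ | ∃ Ω : Matrix
          ((AntisymPurity.Word n d × AntisymPurity.Word n d) ×
            (AntisymPurity.Word n d × AntisymPurity.Word n d))
          ((AntisymPurity.Word n d × AntisymPurity.Word n d) ×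
            (AntisymPurity.Word n d × AntisymPurity.Word n d)) ℂ,
        AntisymPurity.IsFeasible Ω ∧ t = AntisymPurity.flipValue Ω} M := by
  obtain ⟨ψ₀, hψ₀⟩ := AntisymPurity.exists_unit_mem_wedgePow n hd
  obtain ⟨ψ, ⟨hψ, h1⟩, hmax⟩ := (AntisymPurity.isCompact_unit_wedgePow n d).exists_isMaxOn
    ⟨ψ₀, hψ₀⟩ (AntisymPurity.continuous_purity n d).continuousOn
  refine ⟨AntisymPurity.purity ψ, ⟨⟨ψ, hψ, h1, rfl⟩, ?_⟩, ?_, ?_⟩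
  · rintro _ ⟨φ, hφ, hφ1, rfl⟩
    exact hmax ⟨hφ, hφ1⟩
  · obtain ⟨Ω, hΩ, hval⟩ := AntisymPurity.exists_isFeasible hd hψ h1
    exact ⟨Ω, hΩ, hval.symm⟩
  · rintro _ ⟨Ω, hΩ, rfl⟩
    exact hΩ.flipValue_le hd fun φ hφ hφ1 => hmax ⟨hφ, hφ1⟩
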